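/- **Setting.** Let $q,b_1,b_2,b_3,b_4,b_6\in\mathbb C$ with $0<|q|<1$, $b_1b_2b_3b_4=1$, $b_6\neq0$, and write $(a;q)_\infty=\prod_{j\ge0}(1-aq^j)$, $(a_1,\dots,a_k;q)_\infty=\prod_i(a_i;q)_\infty$. For $t\neq 0$ let $$w(x;t)=\frac{(b_2x,\,b_3x,\,b_6^{-1}xt^{-1};q)_\infty}{(b_1x,\,b_4x,\,b_6xt^{-1};q)_\infty}$$ be the deformed big $q$-Jacobi weight, and let $\int F(x)\,d_qx=\int_0^{c_2}F\,d_qx-\int_0^{c_1}F\,d_qx$, $\int_0^cF\,d_qx=(1-q)\sum_{s\ge0}cq^sF(cq^s)$, where each of the terminals $c_1,c_2$ is one of the zeros $b_2^{-1},b_3^{-1},b_6t$ of the weight (the same choice for all $t$), and no point $c_iq^s$, $s\ge0$, is a pole of $w(\cdot\,;t)$. Let $n\ge0$ and let $p_0,\dots,p_n$ (depending on $t$) be polynomials with $\deg p_k=k$ and $\int w\,p_kp_m\,d_qx=\delta_{km}$ for $k,m\le n$. Let $a_k=\int w\,x\,p_kp_{k-1}\,d_qx$ for $k\ge1$ be the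 coefficients of the three-term recurrence $a_{k+1}p_{k+1}=(x-b_k)p_k-a_kp_{k-1}$ (the recurrence coefficients $b_k$ are not used below), and let $a_0=a_0(t)$ be an arbitrary number. Put $q_k(x)=\int w(y)p_k(y)(x-y)^{-1}d_qy$ for $k\ge0$, $p_{-1}=0$, $q_{-1}=1/(a_0p_0)$, and $$Y_n(x;t)=\begin{pmatrix}p_n&q_n/w\\ p_{n-1}&q_{n-1}/w\end{pmatrix}.$$ Let $A_n^*(x;t)=\begin{pmatrix}\mathfrak W_+&-\mathfrak T_+\\ \mathfrak T_-&\mathfrak W_-\end{pmatrix}$ be the matrix with entries polynomial in $x$ such that $$b_6(1-b_1x)(1-b_4x)(t-b_6x)\,Y_n(qx;t)=A^*_n(x;t)\,Y_n(x;t)$$ for all $x\ne0$ off the lattices $c_iq^{\mathbb Z}$ at which neither the numerator nor the denominator of $w$ vanishes. Write $\mathfrak T_+=(q-1)x\,a_n\Theta_n(x)$ and let $g(t)$ be the zero of $\Theta_n$. Put $b_5=q^nb_1b_4b_6$, $\kappa_+=-b_5b_6$, $\kappa_-=-b_6/b_5$, and define $z_\pm$ by $$\tfrac12(\mathfrak W_++\mathfrak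 W_-)\big|_{x=g}=\tfrac12g\,(\kappa_+z_++\kappa_-z_-),\qquad \frac{(\mathfrak W_+-\mathfrak W_-)|_{x=g}}{2(q-1)g}=\frac{\kappa_+z_+-\kappa_-z_-}{2(q-1)} .$$ Finally let $$\mathcal Z(t)=-\frac{b_5b_6t}{(g-b_6t)(b_6g-t)}z_++\frac{b_5tg-1}{g},\qquad f(t)=b_5qt-\mathcal Z(qt),\qquad \check f(t)=f(q^{-1}t)=b_5t-\mathcal Z(t).$$ **Proposition.** Assume $t\neq0$, $qb_5^2\neq1$, and that at both times $s=t$ and $s=qt$ the setting above is in force (no poles on the support, $p_0,\dots,p_n$ as above), $a_n(s)\neq0$, and $g(s)\neq0,\ b_6s,\ b_6^{-1}s$. Then $$\bigl(g\check f-1\bigr)\bigl(gf-1\bigr)=t^2\,\frac{(g-b_1^{-1})(g-b_2^{-1})(g-b_3^{-1})(g-b_4^{-1})}{(g-b_6t)(g-b_6^{-1}t)},$$ where $g,f,\check f$ are taken at $t$. -/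

import Mathlib

open scoped Polynomial

noncomputable section

namespace DeformedBigQJacobi

/-- The parameters of the deformed big `q`-Jacobi weight. -/
structure Params where
  q : ℂ
  b1 : ℂ
  b2 : ℂ
  b3 : ℂ
  b4 : ℂ
  b6 : ℂ
  q_ne_zero : q ≠ 0
  norm_q_lt_one : ‖q‖ < 1
  prod_eq_one : b1 * b2 * b3 * b4 = 1
  b6_ne_zero : b6 ≠ 0

/-- The `q`-shifted factorial `(a; q)_∞ = ∏_{j ≥ 0} (1 - a q^j)`. -/
def qPoch (a q : ℂ) : ℂ := ∏' j : ℕ, (1 - a * q ^ j)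

namespace Params

variable (P : Params)

/-- Numerator of the weight, `(b₂ x, b₃ x, b₆⁻¹ x t⁻¹; q)_∞`. -/
def weightNum (t x : ℂ) : ℂ :=
  qPoch (P.b2 * x) P.q * qPoch (P.b3 * x) P.q * qPoch (P.b6⁻¹ * x * t⁻¹) P.q

/-- Denominator of the weight, `(b₁ x, b₄ x, b₆ x t⁻¹; q)_∞`. -/
def weightDen (t x : ℂ) : ℂ :=
  qPoch (P.b1 * x) P.q * qPoch (P.b4 * x) P.q * qPoch (P.b6 * x * t⁻¹) P.q

/-- The deformed big `q`-Jacobi weight `w(x; t)`. -/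
def weight (t x : ℂ) : ℂ := P.weightNum t x / P.weightDen t x

/-- The spectral data polynomial `W + Δy V`; together with
`W - Δy V = (1 - b₂ x)(1 - b₃ x)(b₆ t - x)` it satisfies
`w(q x; t) / w(x; t) = (W + Δy V) / (W - Δy V)`. -/
def spectralPlus (t x : ℂ) : ℂ :=
  P.b6 * (1 - P.b1 * x) * (1 - P.b4 * x) * (t - P.b6 * x)

/-- The zeros `b₂⁻¹, b₃⁻¹, b₆ t` of the weight, used as terminals of the `q`-integral.
(The other zeros are `q^{-k}` times these, and give the same integrals.) -/
def terminal (t : ℂ) : Fin 3 → ℂ := ![P.b2⁻¹, P.b3⁻¹, P.b6 * t]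

/-- The half-infinite Thomae-Jackson integral `∫_0^c F(x) d_q x`. -/
def jacksonFrom (c : ℂ) (F : ℂ → ℂ) : ℂ :=
  (1 - P.q) * ∑' s : ℕ, c * P.q ^ s * F (c * P.q ^ s)

end Params

/-- A system: the parameters, the choice of the two terminals of the `q`-integral, the degree `n`,
a sequence of polynomials `p t 0, p t 1, …` for each `t`, and the conventional
coefficient `a₀(t)`. -/
structure System extends Params where
  lower : Fin 3
  upper : Fin 3
  n : ℕ
  p : ℂ → ℕ → ℂ[X]
  a0 : ℂ → ℂ

namespace System

variable (S : System)

/-- The Thomae-Jackson integral `∫ F(x) d_q x` between the two terminals, at time `t`. -/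
def integral (t : ℂ) (F : ℂ → ℂ) : ℂ :=
  S.jacksonFrom (S.terminal t S.upper) F - S.jacksonFrom (S.terminal t S.lower) F

/-- No point of the support of the `q`-integral at time `t` is a pole of the weight. -/
def SupportRegular (t : ℂ) : Prop :=
  ∀ s : ℕ, S.weightDen t (S.terminal t S.lower * S.q ^ s) ≠ 0 ∧
    S.weightDen t (S.terminal t S.upper * S.q ^ s) ≠ 0

/-- The polynomials `p_0, …, p_n` at time `t` have exact degrees `0, …, n` and are orthonormal
with respect to `w(x; t)`. The normalisation `h_k = 1` is the one for which the three-term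
recurrence has the symmetric form `a_{k+1} p_{k+1} = (x - b_k) p_k - a_k p_{k-1}` and
`q_k = γ_k⁻¹ x^{-k-1} + ⋯`, with `γ_k` the leading coefficient of `p_k`. -/
def IsOrthonormal (t : ℂ) : Prop :=
  (∀ k ≤ S.n, (S.p t k).degree = k) ∧
  ∀ k ≤ S.n, ∀ m ≤ S.n,
    S.integral t (fun x => S.weight t x * ((S.p t k).eval x * (S.p t m).eval x)) =
      if k = m then 1 else 0

/-- The recurrence coefficient `a_k(t)`: it is `∫ w x p_k p_{k-1} d_q x` for `k ≥ 1`, and the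
conventional number `a₀(t)` for `k = 0`. -/
def a (t : ℂ) : ℕ → ℂ
  | 0 => S.a0 t
  | k + 1 => S.integral t
      (fun x => S.weight t x * (x * ((S.p t (k + 1)).eval x * (S.p t k).eval x)))

/-- The associated function `q_k(x) = ∫ w(y) p_k(y) / (x - y) d_q y`. -/
def assoc (t : ℂ) (k : ℕ) (x : ℂ) : ℂ :=
  S.integral t (fun y => S.weight t y * (S.p t k).eval y / (x - y))

/-- `p_{k-1}(x)`, with `p_{-1} = 0`. -/
def pPrev (t x : ℂ) : ℕ → ℂ
  | 0 => 0
  | k + 1 => (S.p t k).eval x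

/-- `q_{k-1}(x)`, with `q_{-1} = 1 / (a₀ γ₀)`. -/
def assocPrev (t x : ℂ) : ℕ → ℂ
  | 0 => 1 / (S.a0 t * (S.p t 0).leadingCoeff)
  | k + 1 => S.assoc t k x

/-- The matrix `Y_n(x; t)` with rows `(p_n, q_n / w)` and `(p_{n-1}, q_{n-1} / w)`. -/
def Y (t x : ℂ) : Matrix (Fin 2) (Fin 2) ℂ :=
  !![(S.p t S.n).eval x, S.assoc t S.n x / S.weight t x;
     S.pPrev t x S.n, S.assocPrev t x S.n / S.weight t x]

/-- `x` is off the lattice (generated by the terminals) and is neither a zero nor a pole of the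
weight, so that `Y_n` is defined at `x` and at `q x`. -/
def IsGeneric (t x : ℂ) : Prop :=
  x ≠ 0 ∧ S.weightNum t x ≠ 0 ∧ S.weightDen t x ≠ 0 ∧
    ∀ s : ℤ, x ≠ S.terminal t S.lower * S.q ^ s ∧ x ≠ S.terminal t S.upper * S.q ^ s

/-- The spectral `q`-difference equation `(W + Δy V)(x) Y_n(q x) = A(x) Y_n(x)` for a matrix `A`
of polynomials. With `y₊ = q x`, `y₋ = x` the equation `𝔻_x Y_n = A_n 𝕄_x Y_n` reads
`(1 - ½ Δy A_n) Y_n(q x) = (1 + ½ Δy A_n) Y_n(x)`, so `A` is `W + Δy V` times the Cayley transform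
of the spectral matrix `A_n`. -/
def IsSpectral (t : ℂ) (A : Matrix (Fin 2) (Fin 2) ℂ[X]) : Prop :=
  ∀ x, S.IsGeneric t x →
    S.spectralPlus t x • S.Y t (S.q * x) = A.map (fun P => P.eval x) * S.Y t x

/-- The matrix `A*_n(x; t)` with rows `(𝔚₊, -𝔗₊)` and `(𝔗₋, 𝔚₋)`: the polynomial matrix that
satisfies the spectral equation. -/
def spectralMatrix (t : ℂ) : Matrix (Fin 2) (Fin 2) ℂ[X] :=
  Classical.epsilon (S.IsSpectral t)

/-- The polynomial `Θ_n`, from `𝔗₊ = Δy a_n Θ_n` with `Δy = (q - 1) x`. -/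
def theta (t : ℂ) : ℂ[X] :=
  Polynomial.C (((S.q - 1) * S.a t S.n)⁻¹) * (-(S.spectralMatrix t 0 1)).divX

/-- `g(t) = λ_n(t)`, the zero of `Θ_n`. -/
def g (t : ℂ) : ℂ := Classical.epsilon fun z => (S.theta t).IsRoot z

/-- The parameter `b₅`, defined by `q^n = b₅ / (b₁ b₄ b₆)`. -/
def b5 : ℂ := S.q ^ S.n * (S.b1 * S.b4 * S.b6)

/-- `ν_n = (2 W_n - W)(λ_n)`, where `𝔚₊ + 𝔚₋ = 2 (2 W_n - W)`. -/
def nu (t : ℂ) : ℂ :=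
  ((S.spectralMatrix t 0 0).eval (S.g t) + (S.spectralMatrix t 1 1).eval (S.g t)) / 2

/-- `μ_n = (Ω_n + V)(λ_n)`, where `𝔚₊ - 𝔚₋ = 2 Δy (Ω_n + V)`. -/
def mu (t : ℂ) : ℂ :=
  ((S.spectralMatrix t 0 0).eval (S.g t) - (S.spectralMatrix t 1 1).eval (S.g t)) /
    (2 * ((S.q - 1) * S.g t))

/-- `κ₊ = -b₅ b₆`. -/
def kappaPlus : ℂ := -(S.b5 * S.b6)

/-- The variable `z₊`, obtained by solving `ν_n = ½ λ_n (κ₊ z₊ + κ₋ z₋)` and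
`μ_n = (κ₊ z₊ - κ₋ z₋) / (2 (q - 1))`. -/
def zPlus (t : ℂ) : ℂ := (S.nu t / S.g t + (S.q - 1) * S.mu t) / S.kappaPlus

/-- The variable `𝒵(t)`. -/
def Z (t : ℂ) : ℂ :=
  -(S.b5 * S.b6 * t / ((S.g t - S.b6 * t) * (S.b6 * S.g t - t)) * S.zPlus t) +
    (S.b5 * t * S.g t - 1) / S.g t

/-- The variable `f(t)`, from `𝒵(t) = b₅ t - f(q⁻¹ t)`. -/
def f (t : ℂ) : ℂ := S.b5 * (S.q * t) - S.Z (S.q * t)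

end System

end DeformedBigQJacobi

end

/-!
The matrices `Y_n(q x; t)`, `Y_n(x; q t)` and `Y_n(q x; q t)` are obtained from `Y_n(x; t)` by left
multiplication with matrices that are rational in `x`. Let `A`, `B`, `N` be these matrices after
multiplication by `W + Δy V`, `b₆ q t - x` and `(1 - b₁ x)(1 - b₄ x)` respectively. All three are
polynomial for the same reason: their entries have the form `σ₂ p q' - σ₁ p' q`, where `q`, `q'` are
Cauchy transforms of `w p`, `w' p'` and the weights satisfy a Pearson equation `σ₂ w' = σ₁ w`.
Multiplying a Cauchy transform by a polynomial changes it only by a polynomial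
(`exists_mul_cauchy`), and the transcendental parts cancel (`exists_cauchy_sub_cauchy`,
`exists_transfer`). The coefficients of these polynomials are moments, so orthogonality bounds the
degrees (`transfer_coeff_eq`): the upper right entries of `A`, `B`, `N` are a quadratic `τ`, a
constant `u` and a polynomial `ℓ` of degree at most one. At the origin the integrands combine to a
`q`-derivative (`transfer_coeff_zero`), so that, with entries numbered from `0`, `τ(0) = 0` and
`A₁₁(0) = b₆ t`. Hence `τ` is a multiple of `x (x - g)`.

Going from `Y_n(x; t)` to `Y_n(q x; q t)` in two ways gives, with `D = (b₆ t - x)(t - b₆ x)` and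
hats for the time `q t`, the factorisations `B(q x) A(x) = b₆ q D N` and `Â B = b₆ D̂ N`
(`exists_compatibility`). In the upper right entry, `τ` drops out at `x = 0` and `x = g`, and `τ̂`
at `x = ĝ`, which leaves `u = b₆ q t ℓ(0)`, `u A₁₁(g) = b₆ q D(g) ℓ(g)` and
`u Â₀₀(ĝ) = b₆ D̂(ĝ) ℓ(ĝ)`. The first and the last relation give `f = -q t b₆ ℓ'(0) / u`, whence
`g f - 1 = -q t b₆ ℓ(g) / u = -t A₁₁(g) / D(g)`. By definition `g f(q⁻¹ t) - 1` is
`-t A₀₀(g) / D(g)` (`g_mul_sub_one`), and `A₀₀(g) A₁₁(g) = det A(g)` is a product of linear factors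
(`det_spectralMatrix`).

No genericity of `b₆` is needed, since `ℓ` is constructed as a polynomial and not by cancelling
common zeros. The division by `u` is legitimate: if `u = 0` then `ℓ` vanishes at `0` and `g`, so
`ℓ = 0` and `B₀₀(q x) τ(x) = 0`, although neither factor is zero.
-/

namespace DeformedBigQJacobi

open Filter Topology Polynomial

/-! ### The `q`-shifted factorial -/

theorem multipliable_qPoch {q : ℂ} (hq : ‖q‖ < 1) (a : ℂ) :
    Multipliable fun j : ℕ => 1 - a * q ^ j := by
  have h : Summable fun j : ℕ => ‖-(a * q ^ j)‖ := by
    simpa [norm_mul, norm_pow] using (summable_geometric_of_lt_one (norm_nonneg q) hq).mul_left ‖a‖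
  simpa [sub_eq_add_neg] using multipliable_one_add_of_summable h

theorem qPoch_eq_mul {q : ℂ} (hq : ‖q‖ < 1) (a : ℂ) :
    qPoch a q = (1 - a) * qPoch (q * a) q := by
  have h : (fun j : ℕ => 1 - a * q ^ (j + 1)) = fun j => 1 - q * a * q ^ j := by
    funext j; ring
  unfold qPoch
  rw [tprod_eq_zero_mul' (by simpa only [h] using multipliable_qPoch hq (q * a)), h]
  simp

@[simp] theorem qPoch_zero (q : ℂ) : qPoch 0 q = 1 := by simp [qPoch]

theorem qPoch_one {q : ℂ} (hq : ‖q‖ < 1) : qPoch 1 q = 0 := by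
  rw [qPoch_eq_mul hq]; simp

theorem norm_qPoch_sub_one_le {q : ℂ} (hq : ‖q‖ < 1) (a : ℂ) :
    ‖qPoch a q - 1‖ ≤ Real.exp (‖a‖ * (1 - ‖q‖)⁻¹) - 1 := by
  have hs := summable_geometric_of_lt_one (norm_nonneg q) hq
  refine le_of_tendsto (((multipliable_qPoch hq a).hasProd.sub_const 1).norm)
    (Eventually.of_forall fun s => ?_)
  have h := s.norm_prod_one_add_sub_one_le fun j => -(a * q ^ j)
  simp only [← sub_eq_add_neg, norm_neg, norm_mul, norm_pow] at h
  refine h.trans (sub_le_sub_right (Real.exp_le_exp.2 ?_) 1)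
  rw [← Finset.mul_sum, ← tsum_geometric_of_lt_one (norm_nonneg q) hq]
  exact mul_le_mul_of_nonneg_left (hs.sum_le_tsum s fun _ _ => by positivity) (norm_nonneg a)

theorem continuousAt_qPoch_zero {q : ℂ} (hq : ‖q‖ < 1) : ContinuousAt (fun a => qPoch a q) 0 := by
  rw [ContinuousAt, qPoch_zero, tendsto_iff_norm_sub_tendsto_zero]
  refine squeeze_zero (fun _ => norm_nonneg _) (norm_qPoch_sub_one_le hq) ?_
  have : Continuous fun a : ℂ => Real.exp (‖a‖ * (1 - ‖q‖)⁻¹) - 1 := by fun_prop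
  simpa using this.tendsto 0

theorem continuousAt_qPoch_comp_mul {q : ℂ} (hq : ‖q‖ < 1) (b : ℂ) :
    ContinuousAt (fun x => qPoch (b * x) q) 0 := by
  have h : ContinuousAt (fun x : ℂ => b * x) 0 := by fun_prop
  exact ContinuousAt.comp (g := fun a => qPoch a q) (by simpa using continuousAt_qPoch_zero hq) h

/-! ### The weight -/

namespace Params

variable (P : Params)

theorem q_ne_one : P.q ≠ 1 := fun h => by simpa [h] using P.norm_q_lt_one

theorem b1_ne_zero : P.b1 ≠ 0 := fun h => by simpa [h] using P.prod_eq_one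
theorem b2_ne_zero : P.b2 ≠ 0 := fun h => by simpa [h] using P.prod_eq_one
theorem b3_ne_zero : P.b3 ≠ 0 := fun h => by simpa [h] using P.prod_eq_one
theorem b4_ne_zero : P.b4 ≠ 0 := fun h => by simpa [h] using P.prod_eq_one

/-- `W - Δy V`, the numerator factor of `w(x; t) / w(q x; t)`. -/
def spectralMinus (t x : ℂ) : ℂ := (1 - P.b2 * x) * (1 - P.b3 * x) * (P.b6 * t - x)

@[simp] theorem weightNum_zero (t : ℂ) : P.weightNum t 0 = 1 := by simp [weightNum]

@[simp] theorem weightDen_zero (t : ℂ) : P.weightDen t 0 = 1 := by simp [weightDen]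

theorem continuousAt_weightNum (t : ℂ) : ContinuousAt (P.weightNum t) 0 := by
  have h := continuousAt_qPoch_comp_mul P.norm_q_lt_one
  have e : P.weightNum t = fun x => qPoch (P.b2 * x) P.q * qPoch (P.b3 * x) P.q *
      qPoch (P.b6⁻¹ * t⁻¹ * x) P.q := by
    funext x; simp only [weightNum]; congr 2; ring
  rw [e]
  exact ((h _).mul (h _)).mul (h _)

theorem continuousAt_weightDen (t : ℂ) : ContinuousAt (P.weightDen t) 0 := by
  have h := continuousAt_qPoch_comp_mul P.norm_q_lt_one
  have e : P.weightDen t = fun x => qPoch (P.b1 * x) P.q * qPoch (P.b4 * x) P.q *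
      qPoch (P.b6 * t⁻¹ * x) P.q := by
    funext x; simp only [weightDen]; congr 2; ring
  rw [e]
  exact ((h _).mul (h _)).mul (h _)

theorem continuousAt_weight (t : ℂ) : ContinuousAt (P.weight t) 0 :=
  (P.continuousAt_weightNum t).div (P.continuousAt_weightDen t) (by simp)

theorem weightNum_eq_mul (t x : ℂ) : P.weightNum t x =
    (1 - P.b2 * x) * (1 - P.b3 * x) * (1 - P.b6⁻¹ * x * t⁻¹) * P.weightNum t (P.q * x) := by
  have h := qPoch_eq_mul P.norm_q_lt_one
  simp only [weightNum]
  rw [h (P.b2 * x), h (P.b3 * x), h (P.b6⁻¹ * x * t⁻¹)]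
  ring_nf

theorem weightDen_eq_mul (t x : ℂ) : P.weightDen t x =
    (1 - P.b1 * x) * (1 - P.b4 * x) * (1 - P.b6 * x * t⁻¹) * P.weightDen t (P.q * x) := by
  have h := qPoch_eq_mul P.norm_q_lt_one
  simp only [weightDen]
  rw [h (P.b1 * x), h (P.b4 * x), h (P.b6 * x * t⁻¹)]
  ring_nf

/-- The shift `t ↦ q t` changes only the factor with `b₆`. -/
theorem weightNum_shift_mul (t x : ℂ) :
    P.weightNum (P.q * t) x = (1 - P.b6⁻¹ * x * (P.q * t)⁻¹) * P.weightNum t x := by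
  have h := qPoch_eq_mul P.norm_q_lt_one (P.b6⁻¹ * x * (P.q * t)⁻¹)
  have e : P.q * (P.b6⁻¹ * x * (P.q * t)⁻¹) = P.b6⁻¹ * x * t⁻¹ := by
    have := P.q_ne_zero; rw [mul_inv]; field_simp
  rw [e] at h
  simp only [weightNum]; rw [h]; ring

theorem weightDen_shift_mul (t x : ℂ) :
    P.weightDen (P.q * t) x = (1 - P.b6 * x * (P.q * t)⁻¹) * P.weightDen t x := by
  have h := qPoch_eq_mul P.norm_q_lt_one (P.b6 * x * (P.q * t)⁻¹)
  have e : P.q * (P.b6 * x * (P.q * t)⁻¹) = P.b6 * x * t⁻¹ := by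
    have := P.q_ne_zero; rw [mul_inv]; field_simp
  rw [e] at h
  simp only [weightDen]; rw [h]; ring

theorem weightNum_shift_q (t x : ℂ) : P.weightNum t x =
    (1 - P.b2 * x) * (1 - P.b3 * x) * P.weightNum (P.q * t) (P.q * x) := by
  have h := qPoch_eq_mul P.norm_q_lt_one
  have e : P.b6⁻¹ * (P.q * x) * (P.q * t)⁻¹ = P.b6⁻¹ * x * t⁻¹ := by
    have := P.q_ne_zero; rw [mul_inv]; field_simp
  simp only [weightNum, e]
  rw [h (P.b2 * x), h (P.b3 * x)]
  ring_nf

theorem weightDen_shift_q (t x : ℂ) : P.weightDen t x =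
    (1 - P.b1 * x) * (1 - P.b4 * x) * P.weightDen (P.q * t) (P.q * x) := by
  have h := qPoch_eq_mul P.norm_q_lt_one
  have e : P.b6 * (P.q * x) * (P.q * t)⁻¹ = P.b6 * x * t⁻¹ := by
    have := P.q_ne_zero; rw [mul_inv]; field_simp
  simp only [weightDen, e]
  rw [h (P.b1 * x), h (P.b4 * x)]
  ring_nf

/-- The Pearson equation of the weight in the spectral variable. -/
theorem spectralMinus_mul_weight {t x : ℂ} (ht : t ≠ 0) (hx : P.weightDen t x ≠ 0) :
    P.spectralMinus t x * P.weight t (P.q * x) = P.spectralPlus t x * P.weight t x := by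
  have h6 := P.b6_ne_zero
  have hD := P.weightDen_eq_mul t x
  rw [hD] at hx
  obtain ⟨⟨⟨h1, h2⟩, h3⟩, h4⟩ := by simpa only [mul_ne_zero_iff] using hx
  simp only [weight]
  rw [hD, P.weightNum_eq_mul t x, spectralMinus, spectralPlus]
  have e : t - P.b6 * x = t * (1 - P.b6 * x * t⁻¹) := by field_simp
  have e' : P.b6 * t - x = P.b6 * t * (1 - P.b6⁻¹ * x * t⁻¹) := by field_simp
  rw [e, e']
  generalize 1 - P.b6 * x * t⁻¹ = u at *
  generalize 1 - P.b6⁻¹ * x * t⁻¹ = v at *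
  generalize 1 - P.b1 * x = α at *
  generalize 1 - P.b4 * x = β at *
  generalize P.weightDen t (P.q * x) = d at *
  field_simp

/-- The Pearson equation of the weight in the deformation variable. -/
theorem shift_weight {t x : ℂ} (ht : t ≠ 0) (hx : P.weightDen (P.q * t) x ≠ 0) :
    P.b6 * (P.q * t - P.b6 * x) * P.weight (P.q * t) x =
      (P.b6 * (P.q * t) - x) * P.weight t x := by
  have h6 := P.b6_ne_zero
  have hq := P.q_ne_zero
  have hD := P.weightDen_shift_mul t x
  rw [hD] at hx
  obtain ⟨h1, h2⟩ := by simpa only [mul_ne_zero_iff] using hx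
  simp only [weight]
  rw [hD, P.weightNum_shift_mul t x]
  have e : P.q * t - P.b6 * x = P.q * t * (1 - P.b6 * x * (P.q * t)⁻¹) := by field_simp
  have e' : P.b6 * (P.q * t) - x = P.b6 * (P.q * t) * (1 - P.b6⁻¹ * x * (P.q * t)⁻¹) := by
    field_simp
  rw [e, e']
  generalize 1 - P.b6 * x * (P.q * t)⁻¹ = u at *
  generalize 1 - P.b6⁻¹ * x * (P.q * t)⁻¹ = v at *
  field_simp

/-- The Pearson equation of the weight for the simultaneous shift of both variables, which leaves
the factors with `b₆` unchanged. -/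
theorem shift_weight_q {t x : ℂ} (hx : P.weightDen t x ≠ 0) :
    (1 - P.b2 * x) * (1 - P.b3 * x) * P.weight (P.q * t) (P.q * x) =
      (1 - P.b1 * x) * (1 - P.b4 * x) * P.weight t x := by
  have hD := P.weightDen_shift_q t x
  rw [hD] at hx
  obtain ⟨⟨h1, h2⟩, h3⟩ := by simpa only [mul_ne_zero_iff] using hx
  simp only [weight]
  rw [hD, P.weightNum_shift_q t x]
  generalize 1 - P.b1 * x = α at *
  generalize 1 - P.b4 * x = β at *
  generalize P.weightDen (P.q * t) (P.q * x) = d at *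
  field_simp

theorem weightNum_terminal {t : ℂ} (ht : t ≠ 0) (i : Fin 3) :
    P.weightNum t (P.terminal t i) = 0 := by
  have h := qPoch_one P.norm_q_lt_one
  fin_cases i
  · simp [weightNum, terminal, P.b2_ne_zero, h]
  · simp [weightNum, terminal, P.b3_ne_zero, h]
  · simp [weightNum, terminal, P.b6_ne_zero, ht, h]

theorem weight_terminal {t : ℂ} (ht : t ≠ 0) (i : Fin 3) : P.weight t (P.terminal t i) = 0 := by
  simp [weight, P.weightNum_terminal ht]

theorem weight_shift_terminal {t : ℂ} (ht : t ≠ 0) (i : Fin 3) :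
    P.weight (P.q * t) (P.terminal t i) = 0 := by
  simp [weight, P.weightNum_shift_mul, P.weightNum_terminal ht]

/-! ### The Thomae-Jackson integral -/

theorem tendsto_mul_q_pow (c : ℂ) : Tendsto (fun s : ℕ => c * P.q ^ s) atTop (𝓝 0) := by
  simpa using (tendsto_pow_atTop_nhds_zero_of_norm_lt_one P.norm_q_lt_one).const_mul c

/-- Continuity at the origin is all that is required of an integrand: the nodes accumulate only
there, and the `q`-integral then converges absolutely. -/
theorem summable_jackson {F : ℂ → ℂ} (hF : ContinuousAt F 0) (c : ℂ) :
    Summable fun s : ℕ => c * P.q ^ s * F (c * P.q ^ s) := by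
  have h1 : (fun s : ℕ => F (c * P.q ^ s)) =O[atTop] fun _ => (1 : ℝ) :=
    (hF.tendsto.comp (P.tendsto_mul_q_pow c)).isBigO_one ℝ
  have h2 : (fun s : ℕ => c * P.q ^ s) =O[atTop] fun s => ‖P.q‖ ^ s :=
    Asymptotics.IsBigO.of_bound ‖c‖ (Eventually.of_forall fun s => by simp)
  refine summable_of_isBigO_nat (summable_geometric_of_lt_one (norm_nonneg _) P.norm_q_lt_one) ?_
  simpa using h2.mul h1

theorem jacksonFrom_add {F G : ℂ → ℂ} (hF : ContinuousAt F 0) (hG : ContinuousAt G 0) (c : ℂ) :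
    P.jacksonFrom c (fun y => F y + G y) = P.jacksonFrom c F + P.jacksonFrom c G := by
  simp only [jacksonFrom, mul_add]
  rw [(P.summable_jackson hF c).tsum_add (P.summable_jackson hG c), mul_add]

theorem jacksonFrom_const_mul (a c : ℂ) (F : ℂ → ℂ) :
    P.jacksonFrom c (fun y => a * F y) = a * P.jacksonFrom c F := by
  simp only [jacksonFrom, mul_left_comm _ a]
  rw [tsum_mul_left]
  ring

theorem jacksonFrom_mul_q (c : ℂ) (F : ℂ → ℂ) :
    P.jacksonFrom (c * P.q) F = P.q * P.jacksonFrom c (fun y => F (P.q * y)) := by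
  have h : (fun s : ℕ => c * P.q * P.q ^ s * F (c * P.q * P.q ^ s)) =
      fun s => P.q * (c * P.q ^ s * F (P.q * (c * P.q ^ s))) := by
    funext s
    rw [show c * P.q * P.q ^ s = P.q * (c * P.q ^ s) by ring]; ring
  simp only [jacksonFrom]
  rw [h, tsum_mul_left]
  ring

theorem jacksonFrom_eq_add {F : ℂ → ℂ} (hF : ContinuousAt F 0) (c : ℂ) :
    P.jacksonFrom c F = (1 - P.q) * (c * F c) + P.jacksonFrom (c * P.q) F := by
  simp only [jacksonFrom]
  rw [(P.summable_jackson hF c).tsum_eq_zero_add]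
  simp only [pow_zero, mul_one, mul_add, pow_succ', mul_assoc]

/-- The `q`-integral of a `q`-derivative telescopes. -/
theorem jacksonFrom_eq_of_mul_eq_sub {F G : ℂ → ℂ} (hF : ContinuousAt F 0) (hG : ContinuousAt G 0)
    {c : ℂ} (h : ∀ s : ℕ, c * P.q ^ s * F (c * P.q ^ s) =
      G (c * P.q ^ s) - G (P.q * (c * P.q ^ s))) :
    P.jacksonFrom c F = (1 - P.q) * (G c - G 0) := by
  have h1 := (P.summable_jackson hF c).hasSum.tendsto_sum_nat
  have h2 : Tendsto (fun n => G c - G (c * P.q ^ n)) atTop (𝓝 (G c - G 0)) :=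
    tendsto_const_nhds.sub (hG.tendsto.comp (P.tendsto_mul_q_pow c))
  have h3 : (fun n : ℕ => ∑ s ∈ Finset.range n, c * P.q ^ s * F (c * P.q ^ s)) =
      fun n => G c - G (c * P.q ^ n) := by
    funext n
    have : ∀ s : ℕ, P.q * (c * P.q ^ s) = c * P.q ^ (s + 1) := fun s => by ring
    simp only [h, this]
    rw [Finset.sum_range_sub' (fun s => G (c * P.q ^ s))]
    simp
  rw [h3] at h1
  rw [jacksonFrom, tendsto_nhds_unique h1 h2]

end Params

namespace System

variable (S : System)

/-- The points at which the integrand of the Thomae-Jackson integral at time `t` is evaluated. -/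
def support (t : ℂ) : Set ℂ :=
  {y | ∃ s : ℕ, y = S.terminal t S.lower * S.q ^ s ∨ y = S.terminal t S.upper * S.q ^ s}

variable {S} {t : ℂ}

theorem weightDen_ne_zero_of_mem_support (h : S.SupportRegular t) {y : ℂ} (hy : y ∈ S.support t) :
    S.weightDen t y ≠ 0 := by
  obtain ⟨s, rfl | rfl⟩ := hy
  exacts [(h s).1, (h s).2]

theorem integral_congr {F G : ℂ → ℂ} (h : ∀ y ∈ S.support t, F y = G y) :
    S.integral t F = S.integral t G := by
  simp only [integral, Params.jacksonFrom]
  congr 3 <;> funext s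
  · rw [h _ ⟨s, Or.inr rfl⟩]
  · rw [h _ ⟨s, Or.inl rfl⟩]

theorem integral_add {F G : ℂ → ℂ} (hF : ContinuousAt F 0) (hG : ContinuousAt G 0) :
    S.integral t (fun y => F y + G y) = S.integral t F + S.integral t G := by
  simp only [integral, S.jacksonFrom_add hF hG]; ring

theorem integral_const_mul (a : ℂ) (F : ℂ → ℂ) :
    S.integral t (fun y => a * F y) = a * S.integral t F := by
  simp only [integral, S.jacksonFrom_const_mul]; ring

theorem integral_sub {F G : ℂ → ℂ} (hF : ContinuousAt F 0) (hG : ContinuousAt G 0) :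
    S.integral t (fun y => F y - G y) = S.integral t F - S.integral t G := by
  have h := integral_add (S := S) (t := t) (G := fun y => -1 * G y) hF (continuousAt_const.mul hG)
  rw [integral_const_mul] at h
  simpa [← sub_eq_add_neg] using h

/-- A function that vanishes at both terminals can be rescaled by `q` under the integral. -/
theorem integral_scale {F : ℂ → ℂ} (hF : ContinuousAt F 0)
    (h : ∀ i, F (S.terminal t i) = 0) :
    S.integral t F = S.q * S.integral t (fun y => F (S.q * y)) := by
  simp only [integral]
  rw [S.jacksonFrom_eq_add hF (S.terminal t S.upper),
    S.jacksonFrom_eq_add hF (S.terminal t S.lower),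
    h, h, S.jacksonFrom_mul_q, S.jacksonFrom_mul_q]
  ring

/-- The terminals at time `q t` may be replaced by those at time `t` for an integrand that vanishes
at the latter. -/
theorem integral_shift {F : ℂ → ℂ} (hF : ContinuousAt F 0)
    (h : ∀ i, F (S.terminal t i) = 0) :
    S.integral (S.q * t) F = S.integral t F := by
  have key : ∀ i, S.jacksonFrom (S.terminal (S.q * t) i) F = S.jacksonFrom (S.terminal t i) F := by
    intro i
    fin_cases i
    · simp [Params.terminal]
    · simp [Params.terminal]
    · rw [S.jacksonFrom_eq_add hF (S.terminal t _), h]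
      simp only [Params.terminal]
      simp [mul_comm, mul_left_comm]
  simp only [integral, key]

/-- The `q`-integral of a `q`-derivative vanishes if the terminal values do; the boundary terms at
the origin of the two halves of the integral cancel. -/
theorem integral_eq_zero_of_mul_eq_sub {F G : ℂ → ℂ} (hF : ContinuousAt F 0)
    (hG : ContinuousAt G 0) (h : ∀ i, G (S.terminal t i) = 0)
    (hFG : ∀ y ∈ S.support t, y * F y = G y - G (S.q * y)) : S.integral t F = 0 := by
  simp only [integral]
  rw [S.jacksonFrom_eq_of_mul_eq_sub hF hG fun s => hFG _ ⟨s, Or.inr rfl⟩,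
    S.jacksonFrom_eq_of_mul_eq_sub hF hG fun s => hFG _ ⟨s, Or.inl rfl⟩, h, h, sub_self]

/-! ### Cauchy transforms -/

variable (S) in
/-- The Cauchy (Stieltjes) transform `∫ V(y) / (x - y) d_q y`. -/
noncomputable def cauchy (t : ℂ) (V : ℂ → ℂ) (x : ℂ) : ℂ := S.integral t fun y => V y / (x - y)

theorem continuousAt_mul_eval {V : ℂ → ℂ} (hV : ContinuousAt V 0) (F : ℂ[X]) :
    ContinuousAt (fun y => V y * F.eval y) 0 := hV.mul F.continuous.continuousAt

theorem continuousAt_div_sub {V : ℂ → ℂ} (hV : ContinuousAt V 0) {x : ℂ} (hx : x ≠ 0) :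
    ContinuousAt (fun y => V y / (x - y)) 0 :=
  hV.div (by fun_prop) (by simpa using hx)

/-- Multiplying a Cauchy transform by a polynomial gives the Cauchy transform of the product up to
a polynomial, whose coefficients are moments. -/
theorem exists_mul_cauchy {V : ℂ → ℂ} (hV : ContinuousAt V 0) (F : ℂ[X]) :
    ∃ R : ℂ[X], (∀ j, R.coeff j = S.integral t fun y => V y * (divX^[j + 1] F).eval y) ∧
      ∀ x, x ≠ 0 → x ∉ S.support t →
        F.eval x * S.cauchy t V x = S.cauchy t (fun y => V y * F.eval y) x + R.eval x := by
  induction h : F.natDegree generalizing F with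
  | zero =>
    obtain ⟨a, rfl⟩ := natDegree_eq_zero.1 h
    refine ⟨0, fun j => ?_, fun x _ _ => ?_⟩
    · have h0 : divX^[j + 1] (C a) = 0 := by
        rw [Function.iterate_succ_apply, divX_C]
        exact Function.iterate_fixed divX_zero j
      simpa [h0] using (integral_const_mul (S := S) (t := t) 0 fun _ => 0).symm
    · simp only [cauchy, eval_C, eval_zero, add_zero]
      rw [← integral_const_mul]
      congr 1; funext y; ring
  | succ d ih =>
    obtain ⟨R, hR, hR'⟩ := ih F.divX (by rw [natDegree_divX_eq_natDegree_tsub_one, h]; rfl)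
    refine ⟨R * X + C (S.integral t fun y => V y * F.divX.eval y), fun j => ?_, fun x hx hxs => ?_⟩
    · cases j with
      | zero => simp
      | succ j => simp [hR]
    · have hF : ∀ z, F.eval z = F.divX.eval z * z + F.coeff 0 := fun z => by
        conv_lhs => rw [← divX_mul_X_add F]
        simp
      have hG := continuousAt_mul_eval hV F.divX
      have e : S.cauchy t (fun y => V y * F.eval y) x =
          x * S.cauchy t (fun y => V y * F.divX.eval y) x -
            S.integral t (fun y => V y * F.divX.eval y) + F.coeff 0 * S.cauchy t V x := by
        simp only [cauchy]
        rw [← integral_const_mul, ← integral_const_mul, ← integral_sub, ← integral_add]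
        · refine integral_congr fun y hy => ?_
          have hxy : x - y ≠ 0 := sub_ne_zero.2 fun h => hxs (h ▸ hy)
          rw [hF]; field_simp; ring
        · exact (continuousAt_const.mul (continuousAt_div_sub hG hx)).sub hG
        · exact continuousAt_const.mul (continuousAt_div_sub hV hx)
        · exact continuousAt_const.mul (continuousAt_div_sub hG hx)
        · exact hG
      rw [e, hF]
      simp only [eval_add, eval_mul, eval_X, eval_C]
      linear_combination x * hR' x hx hxs

/-- If `V₂ F₂ = V₁ F₁` on the support then `F₂ ⬝ cauchy V₂ - F₁ ⬝ cauchy V₁` is a polynomial. -/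
theorem exists_cauchy_sub_cauchy {V₁ V₂ : ℂ → ℂ} (hV₁ : ContinuousAt V₁ 0)
    (hV₂ : ContinuousAt V₂ 0) {F₁ F₂ : ℂ[X]}
    (h : ∀ y ∈ S.support t, V₂ y * F₂.eval y = V₁ y * F₁.eval y) :
    ∃ K : ℂ[X], (∀ j, K.coeff j = (S.integral t fun y => V₂ y * (divX^[j + 1] F₂).eval y) -
        S.integral t fun y => V₁ y * (divX^[j + 1] F₁).eval y) ∧
      ∀ x, x ≠ 0 → x ∉ S.support t →
        K.eval x = F₂.eval x * S.cauchy t V₂ x - F₁.eval x * S.cauchy t V₁ x := by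
  obtain ⟨R₁, h₁, h₁'⟩ := S.exists_mul_cauchy (t := t) hV₁ F₁
  obtain ⟨R₂, h₂, h₂'⟩ := S.exists_mul_cauchy (t := t) hV₂ F₂
  refine ⟨R₂ - R₁, fun j => by rw [coeff_sub, h₁, h₂], fun x hx hxs => ?_⟩
  have e : S.cauchy t (fun y => V₂ y * F₂.eval y) x = S.cauchy t (fun y => V₁ y * F₁.eval y) x :=
    integral_congr fun y hy => by simp only [h y hy]
  rw [h₁' x hx hxs, h₂' x hx hxs, e, eval_sub]
  ring

/-! ### Orthogonality -/

variable (S) in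
/-- The moment functional `h ↦ ∫ w(y; t) h(y) d_q y` on polynomials. -/
noncomputable def moment (t : ℂ) : ℂ[X] →ₗ[ℂ] ℂ where
  toFun h := S.integral t fun y => S.weight t y * h.eval y
  map_add' F G := by
    rw [← integral_add (continuousAt_mul_eval (S.continuousAt_weight t) F)
      (continuousAt_mul_eval (S.continuousAt_weight t) G)]
    simp only [eval_add, mul_add]
  map_smul' a F := by
    simp only [eval_smul, smul_eq_mul, RingHom.id_apply]
    rw [← integral_const_mul]
    congr 1; funext y; ring

theorem moment_apply (h : ℂ[X]) :
    S.moment t h = S.integral t fun y => S.weight t y * h.eval y := rfl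

variable (hO : S.IsOrthonormal t)
include hO

theorem natDegree_p {k : ℕ} (hk : k ≤ S.n) : (S.p t k).natDegree = k :=
  natDegree_eq_of_degree_eq_some (hO.1 k hk)

theorem leadingCoeff_p_ne_zero {k : ℕ} (hk : k ≤ S.n) : (S.p t k).leadingCoeff ≠ 0 := by
  rw [Ne, leadingCoeff_eq_zero]
  rintro h
  simpa [h] using hO.1 k hk

theorem coeff_p {k : ℕ} (hk : k ≤ S.n) : (S.p t k).coeff k = (S.p t k).leadingCoeff := by
  rw [leadingCoeff, natDegree_p hO hk]

theorem moment_p_mul_p {k m : ℕ} (hk : k ≤ S.n) (hm : m ≤ S.n) :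
    S.moment t (S.p t k * S.p t m) = if k = m then 1 else 0 := by
  rw [← hO.2 k hk m hm, moment_apply]
  simp only [eval_mul]

/-- Subtracting the right multiple of `p_k` removes the leading term. -/
theorem degree_sub_smul_p_lt {k : ℕ} (hk : k ≤ S.n) {h : ℂ[X]} (hh : h.natDegree ≤ k) :
    (h - (h.coeff k / (S.p t k).leadingCoeff) • S.p t k).degree < k := by
  rw [degree_lt_iff_coeff_zero]
  intro m hm
  rw [coeff_sub, coeff_smul, smul_eq_mul]
  rcases hm.eq_or_lt with rfl | hm
  · rw [coeff_p hO hk, div_mul_cancel₀ _ (leadingCoeff_p_ne_zero hO hk), sub_self]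
  · rw [coeff_eq_zero_of_natDegree_lt (hh.trans_lt hm),
      coeff_eq_zero_of_natDegree_lt (p := S.p t k) (by rwa [natDegree_p hO hk])]
    simp

/-- `p_m` is orthogonal to all polynomials of degree less than `k ≤ m`. -/
theorem moment_p_mul_eq_zero {k : ℕ} :
    ∀ m, k ≤ m → m ≤ S.n → ∀ h : ℂ[X], h.degree < k → S.moment t (S.p t m * h) = 0 := by
  induction k with
  | zero =>
    intro m _ _ h hh
    have : h = 0 := by simpa using hh
    simp [this]
  | succ k ih =>
    intro m hkm hmn h hh
    have hd : h.natDegree ≤ k := natDegree_le_iff_degree_le.2 (by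
      rw [degree_le_iff_coeff_zero]
      intro j hj
      rw [degree_lt_iff_coeff_zero] at hh
      exact hh j (by exact_mod_cast hj))
    have h1 := ih m (by omega) hmn _ (degree_sub_smul_p_lt hO (by omega) hd)
    rwa [mul_sub, mul_smul_comm, map_sub, map_smul, moment_p_mul_p hO hmn (by omega),
      if_neg (by omega), smul_zero, sub_zero] at h1

theorem moment_p_mul {k : ℕ} (hk : k ≤ S.n) {h : ℂ[X]} (hh : h.natDegree ≤ k) :
    S.moment t (S.p t k * h) = h.coeff k / (S.p t k).leadingCoeff := by
  have h1 := moment_p_mul_eq_zero hO k le_rfl hk _ (degree_sub_smul_p_lt hO hk hh)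
  rw [mul_sub, mul_smul_comm, map_sub, map_smul, moment_p_mul_p hO hk hk, if_pos rfl,
    smul_eq_mul, mul_one] at h1
  exact sub_eq_zero.1 h1

theorem a_succ {k : ℕ} (hk : k + 1 ≤ S.n) :
    S.a t (k + 1) = (S.p t k).leadingCoeff / (S.p t (k + 1)).leadingCoeff := by
  have e : S.a t (k + 1) = S.moment t (S.p t (k + 1) * (S.p t k * X)) := by
    simp only [a, moment_apply]
    congr 1; funext y; simp only [eval_mul, eval_X]; ring
  have hd : (S.p t k * X).natDegree ≤ k + 1 := by
    refine natDegree_mul_le.trans ?_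
    rw [natDegree_p hO (by omega), natDegree_X]
  rw [e, moment_p_mul hO hk hd, coeff_mul_X, coeff_p hO (by omega)]

end System

/-! ### Iterated division by `X` and rescaling of polynomials -/

theorem coeff_iterate_divX (F : ℂ[X]) (j m : ℕ) : (divX^[j] F).coeff m = F.coeff (m + j) := by
  induction j generalizing F with
  | zero => rfl
  | succ j ih => rw [Function.iterate_succ_apply, ih, coeff_divX, add_assoc]

theorem natDegree_iterate_divX_le {F : ℂ[X]} {d j : ℕ} (h : F.natDegree ≤ d + j) :
    (divX^[j] F).natDegree ≤ d := by
  rw [natDegree_le_iff_coeff_eq_zero]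
  intro m hm
  rw [coeff_iterate_divX]
  exact coeff_eq_zero_of_natDegree_lt (by omega)

theorem natDegree_comp_C_mul_X_le {F : ℂ[X]} {d : ℕ} (h : F.natDegree ≤ d) (r : ℂ) :
    (F.comp (C r * X)).natDegree ≤ d := by
  rw [natDegree_le_iff_coeff_eq_zero]
  intro m hm
  rw [comp_C_mul_X_coeff, coeff_eq_zero_of_natDegree_lt (by omega), zero_mul]

namespace System

variable (S : System)

/-! ### Rows of `Y_n` -/

/-- The polynomial `p_{k-1}`, with `p_{-1} = 0`. -/
noncomputable def prevPoly (t : ℂ) : ℕ → ℂ[X]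
  | 0 => 0
  | k + 1 => S.p t k

/-- The constant by which `q_{k-1}` exceeds the Cauchy transform of `w p_{k-1}`: zero, except for
the convention for `q_{-1}`. -/
noncomputable def prevConst (t : ℂ) : ℕ → ℂ
  | 0 => 1 / (S.a0 t * (S.p t 0).leadingCoeff)
  | _ + 1 => 0

/-- The polynomials `p_n, p_{n-1}` in the first column of `Y_n`. -/
noncomputable def rowPoly (t : ℂ) : Fin 2 → ℂ[X] := ![S.p t S.n, S.prevPoly t S.n]

/-- The constants by which `q_n, q_{n-1}` exceed the Cauchy transforms of `w p_n, w p_{n-1}`. -/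
noncomputable def rowConst (t : ℂ) : Fin 2 → ℂ := ![0, S.prevConst t S.n]

/-- The functions `q_n, q_{n-1}` in the second column of `Y_n`. -/
noncomputable def second (t : ℂ) (i : Fin 2) (x : ℂ) : ℂ :=
  S.cauchy t (fun y => S.weight t y * (S.rowPoly t i).eval y) x + S.rowConst t i

variable {S} {t : ℂ}

theorem Y_zero (x : ℂ) (i : Fin 2) : S.Y t x i 0 = (S.rowPoly t i).eval x := by
  fin_cases i
  · rfl
  · simp only [Y, rowPoly]
    generalize S.n = n
    cases n <;> simp [pPrev, prevPoly]

theorem Y_one (x : ℂ) (i : Fin 2) : S.Y t x i 1 = S.second t i x / S.weight t x := by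
  fin_cases i
  · simp [Y, second, rowPoly, rowConst, assoc, cauchy]
  · simp only [Y, rowPoly, rowConst, second, cauchy]
    generalize S.n = n
    cases n with
    | zero =>
      have h0 : S.integral t (fun _ => 0) = 0 := by
        simpa using integral_const_mul (S := S) (t := t) 0 fun _ => 0
      simp [assocPrev, prevPoly, prevConst, h0]
    | succ n => simp [assocPrev, prevPoly, prevConst, assoc]

/-- The Casoratian `p_n q_{n-1} - p_{n-1} q_n` is `1 / a_n`; the second statement is the same
identity at the origin, where the associated functions need not be defined. -/
theorem casoratian (hO : S.IsOrthonormal t) (ha : S.a t S.n ≠ 0) :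
    (∀ x, x ≠ 0 → x ∉ S.support t →
      S.a t S.n * ((S.rowPoly t 0).eval x * S.second t 1 x -
        (S.rowPoly t 1).eval x * S.second t 0 x) = 1) ∧
    S.a t S.n * (S.moment t (S.rowPoly t 1 * divX (S.rowPoly t 0)) -
      S.moment t (S.rowPoly t 0 * divX (S.rowPoly t 1)) +
        S.rowConst t 1 * (S.rowPoly t 0).coeff 0) = 1 := by
  -- the coefficients of `a_n` times the Casoratian; `n = 0` uses the convention for `q_{-1}`
  have key : ∀ j, S.a t S.n * (S.moment t (S.rowPoly t 1 * divX^[j + 1] (S.rowPoly t 0)) -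
      S.moment t (S.rowPoly t 0 * divX^[j + 1] (S.rowPoly t 1)) +
        S.rowConst t 1 * (S.rowPoly t 0).coeff j) = if j = 0 then 1 else 0 := by
    intro j
    have h0 : S.rowPoly t 0 = S.p t S.n := rfl
    have hd := natDegree_p hO le_rfl
    have hc := coeff_p hO le_rfl
    have hl := leadingCoeff_p_ne_zero hO le_rfl
    obtain hn | ⟨k, hn⟩ : S.n = 0 ∨ ∃ k, S.n = k + 1 := by
      cases S.n <;> simp
    · have h1 : S.rowPoly t 1 = 0 := by simp [rowPoly, hn, prevPoly]
      have h2 : S.rowConst t 1 = 1 / (S.a0 t * (S.p t 0).leadingCoeff) := by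
        simp [rowConst, hn, prevConst]
      have h3 : divX^[j + 1] (0 : ℂ[X]) = 0 := Function.iterate_fixed divX_zero _
      rw [hn] at ha hd hc hl
      rw [h0, h1, h2, h3, zero_mul, mul_zero, map_zero, hn]
      have ha' : S.a t 0 = S.a0 t := rfl
      rw [ha'] at ha ⊢
      split_ifs with hj
      · rw [hj, hc]; field_simp; ring
      · rw [coeff_eq_zero_of_natDegree_lt (by omega)]; simp
    · have h1 : S.rowPoly t 1 = S.p t k := by simp [rowPoly, hn, prevPoly]
      have h2 : S.rowConst t 1 = 0 := by simp [rowConst, hn, prevConst]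
      have hk : k ≤ S.n := by omega
      have hdk := natDegree_p hO hk
      have hlk := leadingCoeff_p_ne_zero hO hk
      rw [h0, h1, h2, moment_p_mul hO hk (natDegree_iterate_divX_le (by omega)),
        moment_p_mul hO le_rfl (natDegree_iterate_divX_le (by omega)), coeff_iterate_divX,
        coeff_iterate_divX, coeff_eq_zero_of_natDegree_lt (p := S.p t k) (by omega)]
      have ha' : S.a t S.n = (S.p t k).leadingCoeff / (S.p t S.n).leadingCoeff := by
        have := a_succ hO (k := k) (by omega)
        rwa [← hn] at this
      rw [ha']
      split_ifs with hj
      · rw [show k + (j + 1) = S.n by omega, hc]; field_simp; ring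
      · rw [coeff_eq_zero_of_natDegree_lt (by omega)]; simp
  refine ⟨fun x hx hxs => ?_, by simpa using key 0⟩
  have hw := S.continuousAt_weight t
  obtain ⟨K, hK, hK'⟩ := exists_cauchy_sub_cauchy (S := S) (t := t)
    (continuousAt_mul_eval hw (S.rowPoly t 0)) (continuousAt_mul_eval hw (S.rowPoly t 1))
    (F₁ := S.rowPoly t 1) (F₂ := S.rowPoly t 0) fun y _ => by ring
  have hK1 : C (S.a t S.n) * (K + C (S.rowConst t 1) * S.rowPoly t 0) = 1 := by
    ext j
    rw [coeff_C_mul, coeff_add, coeff_C_mul, hK, coeff_one, ← key j]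
    simp only [moment_apply, eval_mul, mul_assoc]
  have h := congrArg (eval x) hK1
  simp only [eval_mul, eval_add, eval_C, eval_one, hK' x hx hxs] at h
  have h0 : S.rowConst t 0 = 0 := rfl
  simp only [second, h0]
  linear_combination h

/-! ### Transfer matrices -/

/-- The relation between the `q`-integrals at times `s` and `t` that a rescaling of the variable by
`r` induces on integrands containing the weight. -/
def IsRescaling (S : System) (t s r : ℂ) : Prop :=
  ∀ H : ℂ → ℂ, ContinuousAt H 0 → S.integral s (fun y => S.weight s y * H y) =
    r * S.integral t (fun y => S.weight s (r * y) * H (r * y))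

theorem isRescaling_q (ht : t ≠ 0) : S.IsRescaling t t S.q := fun _ hH =>
  integral_scale ((S.continuousAt_weight t).mul hH) fun i => by simp [S.weight_terminal ht]

theorem isRescaling_shift (ht : t ≠ 0) : S.IsRescaling t (S.q * t) 1 := fun _ hH => by
  simp only [one_mul]
  exact integral_shift ((S.continuousAt_weight (S.q * t)).mul hH)
    fun i => by simp [S.weight_shift_terminal ht]

theorem isRescaling_shift_q (ht : t ≠ 0) : S.IsRescaling t (S.q * t) S.q := fun _ hH => by
  have hc := (S.continuousAt_weight (S.q * t)).mul hH
  have h0 : ∀ i, S.weight (S.q * t) (S.terminal t i) = 0 := S.weight_shift_terminal ht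
  exact (integral_shift hc fun i => by simp [h0]).trans
    (integral_scale hc fun i => by simp [h0])

theorem continuousAt_comp_mul {H : ℂ → ℂ} (hH : ContinuousAt H 0) (r : ℂ) :
    ContinuousAt (fun y => H (r * y)) 0 :=
  ContinuousAt.comp (g := H) (f := fun y => r * y) (by simpa using hH) (by fun_prop)

/-- The combination of a row of `Y_n(r x; s)` with a row of `Y_n(x; t)` from which the entries of
the transfer matrix are made is a polynomial. -/
theorem exists_transfer_entry {s r : ℂ} (hr : r ≠ 0) (hI : S.IsRescaling t s r) {σ₁ σ₂ : ℂ[X]}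
    (hσ : ∀ y ∈ S.support t, σ₂.eval y * S.weight s (r * y) = σ₁.eval y * S.weight t y)
    (i k : Fin 2) :
    ∃ K : ℂ[X],
      (∀ j, K.coeff j =
        (S.integral t fun y => S.weight s (r * y) * (S.rowPoly s i).eval (r * y) *
          (divX^[j + 1] (σ₂ * S.rowPoly t k)).eval y) -
        (S.integral t fun y => S.weight t y * (S.rowPoly t k).eval y *
          (divX^[j + 1] (σ₁ * (S.rowPoly s i).comp (C r * X))).eval y) +
        S.rowConst s i * (σ₂ * S.rowPoly t k).coeff j -
        S.rowConst t k * (σ₁ * (S.rowPoly s i).comp (C r * X)).coeff j) ∧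
      ∀ x, x ≠ 0 → x ∉ S.support t → K.eval x =
        σ₂.eval x * (S.rowPoly t k).eval x * S.second s i (r * x) -
        σ₁.eval x * (S.rowPoly s i).eval (r * x) * S.second t k x := by
  have hV₂ : ContinuousAt (fun y => S.weight s (r * y) * (S.rowPoly s i).eval (r * y)) 0 :=
    continuousAt_comp_mul (continuousAt_mul_eval (S.continuousAt_weight s) _) r
  obtain ⟨K, hK, hK'⟩ := exists_cauchy_sub_cauchy (S := S) (t := t)
    (continuousAt_mul_eval (S.continuousAt_weight t) (S.rowPoly t k)) hV₂
    (F₁ := σ₁ * (S.rowPoly s i).comp (C r * X)) (F₂ := σ₂ * S.rowPoly t k) fun y hy => by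
      simp only [eval_mul, eval_comp, eval_C, eval_X]
      linear_combination (S.rowPoly s i).eval (r * y) * (S.rowPoly t k).eval y * hσ y hy
  refine ⟨K + C (S.rowConst s i) * (σ₂ * S.rowPoly t k) -
    C (S.rowConst t k) * (σ₁ * (S.rowPoly s i).comp (C r * X)), fun j => ?_, fun x hx hxs => ?_⟩
  · rw [coeff_sub, coeff_add, coeff_C_mul, coeff_C_mul, hK]
  · have e : S.cauchy s (fun y => S.weight s y * (S.rowPoly s i).eval y) (r * x) =
        S.cauchy t (fun y => S.weight s (r * y) * (S.rowPoly s i).eval (r * y)) x := by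
      have h := hI (fun y => (S.rowPoly s i).eval y / (r * x - y))
        (continuousAt_div_sub (S.rowPoly s i).continuous.continuousAt (mul_ne_zero hr hx))
      simp only [cauchy, mul_div_assoc]
      rw [h, ← integral_const_mul]
      congr 1; funext y
      rw [← mul_sub]; field_simp
    rw [second, second, e, eval_sub, eval_add, hK' x hx hxs]
    simp only [eval_mul, eval_comp, eval_C, eval_X]
    ring

/-- **Transfer matrices.** If the weights at times `s` (argument `r x`) and `t` (argument `x`) have
a rational ratio `σ₁ / σ₂` then `σ₁(x) Y_n(r x; s) Y_n(x; t)⁻¹` is a polynomial matrix. Its second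
column is described by its coefficients. -/
theorem exists_transfer (hO : S.IsOrthonormal t) (ha : S.a t S.n ≠ 0) {s r : ℂ} (hr : r ≠ 0)
    (hI : S.IsRescaling t s r) {σ₁ σ₂ : ℂ[X]}
    (hσ : ∀ y ∈ S.support t, σ₂.eval y * S.weight s (r * y) = σ₁.eval y * S.weight t y) :
    ∃ M : Matrix (Fin 2) (Fin 2) ℂ[X],
      (∀ x, x ≠ 0 → x ∉ S.support t → S.weight t x ≠ 0 → S.weight s (r * x) ≠ 0 →
        σ₂.eval x * S.weight s (r * x) = σ₁.eval x * S.weight t x →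
        σ₁.eval x • S.Y s (r * x) = M.map (fun P => P.eval x) * S.Y t x) ∧
      ∀ i j, (M i 1).coeff j = S.a t S.n *
        ((S.integral t fun y => S.weight s (r * y) * (S.rowPoly s i).eval (r * y) *
          (divX^[j + 1] (σ₂ * S.rowPoly t 0)).eval y) -
        (S.integral t fun y => S.weight t y * (S.rowPoly t 0).eval y *
          (divX^[j + 1] (σ₁ * (S.rowPoly s i).comp (C r * X))).eval y) +
        S.rowConst s i * (σ₂ * S.rowPoly t 0).coeff j) := by
  choose K hK hK' using exists_transfer_entry hr hI hσ
  refine ⟨Matrix.of fun i j => if j = 0 then -(C (S.a t S.n) * K i 1) else C (S.a t S.n) * K i 0,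
    fun x hx hxs hwt hws hσx => ?_, fun i j => ?_⟩
  · have hc := (casoratian hO ha).1 x hx hxs
    ext i j
    rw [Matrix.mul_apply, Fin.sum_univ_two]
    fin_cases j <;> simp [Y_zero, Y_one, hK' i _ x hx hxs]
    · linear_combination -(eval x σ₁ * eval (r * x) (S.rowPoly s i)) * hc
    · field_simp
      linear_combination (-(σ₂.eval x * S.second s i (r * x) * S.weight s (r * x))) * hc -
        S.second s i (r * x) * hσx
  · have h0 : S.rowConst t 0 = 0 := rfl
    simp [hK, h0]

/-! ### Coefficients of the transfer matrices -/

/-- Integrals against a rescaled row are moments at time `s`. -/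
theorem integral_rescaled_mul {s r : ℂ} (hr : r ≠ 0) (hI : S.IsRescaling t s r) (P h : ℂ[X]) :
    (S.integral t fun y => S.weight s (r * y) * P.eval (r * y) * h.eval y) =
      r⁻¹ * S.moment s (P * h.comp (C r⁻¹ * X)) := by
  have e := hI (fun y => (P * h.comp (C r⁻¹ * X)).eval y) (Polynomial.continuous _).continuousAt
  rw [moment_apply, e, inv_mul_cancel_left₀ hr]
  congr 1; funext y
  simp [inv_mul_cancel_left₀ hr, mul_assoc]

/-- Orthogonality bounds the degree of the upper right entry of a transfer matrix and determines its
leading coefficient. -/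
theorem transfer_coeff_eq (hO : S.IsOrthonormal t) {s r : ℂ} (hOs : S.IsOrthonormal s)
    (hr : r ≠ 0) (hI : S.IsRescaling t s r) {σ₁ σ₂ : ℂ[X]} {j : ℕ}
    (h₁ : σ₁.natDegree ≤ j + 1) (h₂ : σ₂.natDegree ≤ j + 1) :
    (S.integral t fun y => S.weight s (r * y) * (S.rowPoly s 0).eval (r * y) *
          (divX^[j + 1] (σ₂ * S.rowPoly t 0)).eval y) -
        (S.integral t fun y => S.weight t y * (S.rowPoly t 0).eval y *
          (divX^[j + 1] (σ₁ * (S.rowPoly s 0).comp (C r * X))).eval y) +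
        S.rowConst s 0 * (σ₂ * S.rowPoly t 0).coeff j =
      r⁻¹ * (σ₂.coeff (j + 1) * (S.p t S.n).leadingCoeff * r⁻¹ ^ S.n / (S.p s S.n).leadingCoeff) -
        σ₁.coeff (j + 1) * ((S.p s S.n).leadingCoeff * r ^ S.n) / (S.p t S.n).leadingCoeff := by
  have hs0 : S.rowPoly s 0 = S.p s S.n := rfl
  have ht0 : S.rowPoly t 0 = S.p t S.n := rfl
  have hc : S.rowConst s 0 = 0 := rfl
  have hdt := (natDegree_p hO le_rfl).le
  have hds := natDegree_comp_C_mul_X_le (natDegree_p hOs le_rfl).le r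
  have hd2 : (divX^[j + 1] (σ₂ * S.p t S.n)).natDegree ≤ S.n :=
    natDegree_iterate_divX_le (by have := natDegree_mul_le_of_le h₂ hdt; omega)
  have hd1 : (divX^[j + 1] (σ₁ * (S.p s S.n).comp (C r * X))).natDegree ≤ S.n :=
    natDegree_iterate_divX_le (by have := natDegree_mul_le_of_le h₁ hds; omega)
  have e : (S.integral t fun y => S.weight t y * (S.p t S.n).eval y *
      (divX^[j + 1] (σ₁ * (S.p s S.n).comp (C r * X))).eval y) =
      S.moment t (S.p t S.n * divX^[j + 1] (σ₁ * (S.p s S.n).comp (C r * X))) := by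
    simp only [moment_apply, eval_mul, mul_assoc]
  rw [hs0, ht0, hc, e, integral_rescaled_mul hr hI, moment_p_mul hO le_rfl hd1,
    moment_p_mul hOs le_rfl (natDegree_comp_C_mul_X_le hd2 _), comp_C_mul_X_coeff,
    coeff_iterate_divX, coeff_iterate_divX, add_comm S.n,
    coeff_mul_add_eq_of_natDegree_le h₂ hdt, coeff_mul_add_eq_of_natDegree_le h₁ hds,
    comp_C_mul_X_coeff, coeff_p hO le_rfl, coeff_p hOs le_rfl]
  ring

/-- At the origin the transfer matrix in the spectral direction is a multiple of the Casoratian,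
because the difference of the two integrands is a `q`-derivative. -/
theorem transfer_coeff_zero (ht : t ≠ 0) {σ₁ σ₂ : ℂ[X]} {κ : ℂ} (h₁ : σ₁.coeff 0 = κ)
    (h₂ : σ₂.coeff 0 = κ)
    (hσ : ∀ y ∈ S.support t, σ₂.eval y * S.weight t (S.q * y) = σ₁.eval y * S.weight t y)
    (P p : ℂ[X]) :
    (S.integral t fun y => S.weight t (S.q * y) * P.eval (S.q * y) *
          (divX (σ₂ * p)).eval y) -
        (S.integral t fun y => S.weight t y * p.eval y *
          (divX (σ₁ * P.comp (C S.q * X))).eval y) =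
      κ * (S.moment t (P * divX p) - S.moment t (p * divX P)) := by
  have hw := S.continuousAt_weight t
  have c1 : ContinuousAt (fun y => S.weight t (S.q * y) * P.eval (S.q * y) *
      (divX (σ₂ * p)).eval y) 0 :=
    continuousAt_mul_eval (continuousAt_comp_mul (continuousAt_mul_eval hw P) S.q) _
  have c2 : ContinuousAt (fun y => S.weight t y * p.eval y *
      (divX (σ₁ * P.comp (C S.q * X))).eval y) 0 :=
    continuousAt_mul_eval (continuousAt_mul_eval hw p) _
  have c3 : ContinuousAt (fun y => κ * (S.weight t y * (P * divX p - p * divX P).eval y)) 0 :=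
    continuousAt_const.mul (continuousAt_mul_eval hw _)
  have hd : ∀ (F : ℂ[X]) (y : ℂ), y * (divX F).eval y = F.eval y - F.coeff 0 := fun F y => by
    have h := congrArg (eval y) (divX_mul_X_add F)
    simp only [eval_add, eval_mul, eval_X, eval_C] at h
    linear_combination h
  rw [coeff_zero_eq_eval_zero] at h₁ h₂
  have h := integral_eq_zero_of_mul_eq_sub (S := S) (t := t) ((c1.sub c2).sub c3)
    (G := fun y => κ * p.coeff 0 * (S.weight t y * P.eval y))
    (continuousAt_const.mul (continuousAt_mul_eval hw P))
    (fun i => by simp [S.weight_terminal ht]) fun y hy => by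
      have e1 := hd (σ₂ * p) y
      have e2 := hd (σ₁ * P.comp (C S.q * X)) y
      have e3 := hd p y
      have e4 := hd P y
      have e5 := hσ y hy
      simp only [h₁, h₂, eval_mul, eval_comp, eval_C, eval_X, coeff_zero_eq_eval_zero,
        mul_zero] at e1 e2 e3 e4
      simp only [Pi.sub_apply, eval_sub, eval_mul, coeff_zero_eq_eval_zero]
      linear_combination S.weight t (S.q * y) * P.eval (S.q * y) * e1 -
        S.weight t y * p.eval y * e2 - κ * S.weight t y * P.eval y * e3 +
        κ * S.weight t y * p.eval y * e4 + P.eval (S.q * y) * p.eval y * e5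
  have e := integral_sub (S := S) (t := t) (c1.sub c2) c3
  have e' := integral_sub (S := S) (t := t) c1 c2
  rw [integral_const_mul] at e
  rw [← map_sub, moment_apply, ← e', ← sub_eq_zero, ← h]
  exact e.symm

/-! ### Generic points -/

theorem IsGeneric.mul_q {x : ℂ} (h : S.IsGeneric t x) : S.IsGeneric t (S.q * x) := by
  obtain ⟨h0, hn, hd, hs⟩ := h
  have hq := S.q_ne_zero
  refine ⟨mul_ne_zero hq h0, fun h => hn ?_, fun h => hd ?_, fun s => ?_⟩
  · rw [S.weightNum_eq_mul, h, mul_zero]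
  · rw [S.weightDen_eq_mul, h, mul_zero]
  · have e : ∀ c : ℂ, c * S.q ^ s = S.q * (c * S.q ^ (s - 1)) := fun c => by
      rw [zpow_sub_one₀ hq]; field_simp
    rw [e, e]
    exact ⟨fun h => (hs (s - 1)).1 (mul_left_cancel₀ hq h),
      fun h => (hs (s - 1)).2 (mul_left_cancel₀ hq h)⟩

theorem IsGeneric.notMem_support {x : ℂ} (h : S.IsGeneric t x) : x ∉ S.support t := by
  rintro ⟨s, hs | hs⟩
  · exact (h.2.2.2 s).1 (by simpa using hs)
  · exact (h.2.2.2 s).2 (by simpa using hs)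

theorem IsGeneric.weight_ne_zero {x : ℂ} (h : S.IsGeneric t x) : S.weight t x ≠ 0 :=
  div_ne_zero h.2.1 h.2.2.1

/-- Near the origin only countably many points fail to be generic. -/
theorem infinite_isGeneric (S : System) (t s : ℂ) :
    {x | S.IsGeneric t x ∧ S.IsGeneric s x}.Infinite := by
  intro hfin
  have hev : ∀ u, ∀ᶠ x in 𝓝 (0 : ℂ), S.weightNum u x ≠ 0 ∧ S.weightDen u x ≠ 0 := fun u =>
    ((S.continuousAt_weightNum u).eventually_ne (by simp)).and
      ((S.continuousAt_weightDen u).eventually_ne (by simp))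
  obtain ⟨U, hU, hUo, hU0⟩ := eventually_nhds_iff.1 ((hev t).and (hev s))
  have hL : ∀ c : ℂ, (Set.range fun k : ℤ => c * S.q ^ k).Countable := fun c =>
    Set.countable_range _
  have hcount := (((hfin.countable.union (Set.countable_singleton (0 : ℂ))).union
    ((hL (S.terminal t S.lower)).union (hL (S.terminal t S.upper)))).union
    ((hL (S.terminal s S.lower)).union (hL (S.terminal s S.upper))))
  obtain ⟨x, hxU, hx⟩ := (hcount.dense_compl ℝ).inter_open_nonempty U hUo ⟨0, hU0⟩
  simp only [Set.mem_compl_iff, Set.mem_union, Set.mem_range, Set.mem_singleton_iff, not_or,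
    not_exists] at hx
  obtain ⟨⟨⟨hg, h0⟩, h1, h2⟩, h3, h4⟩ := hx
  have := hU x hxU
  exact hg ⟨⟨h0, this.1.1, this.1.2, fun k => ⟨fun h => h1 k h.symm, fun h => h2 k h.symm⟩⟩,
    ⟨h0, this.2.1, this.2.2, fun k => ⟨fun h => h3 k h.symm, fun h => h4 k h.symm⟩⟩⟩

theorem det_Y (hO : S.IsOrthonormal t) (ha : S.a t S.n ≠ 0) {x : ℂ} (hx : S.IsGeneric t x) :
    S.a t S.n * S.weight t x * (S.Y t x).det = 1 := by
  rw [Matrix.det_fin_two, Y_zero, Y_zero, Y_one, Y_one]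
  have := hx.weight_ne_zero
  have h := (casoratian hO ha).1 x hx.1 hx.notMem_support
  field_simp
  linear_combination h

theorem isUnit_det_Y (hO : S.IsOrthonormal t) (ha : S.a t S.n ≠ 0) {x : ℂ}
    (hx : S.IsGeneric t x) : IsUnit (S.Y t x).det := by
  have h := det_Y hO ha hx
  exact isUnit_iff_ne_zero.2 fun h0 => by simp [h0] at h

/-! ### The spectral matrix -/

/-- `W + Δy V` as a polynomial. -/
noncomputable def plusPoly (S : System) (t : ℂ) : ℂ[X] :=
  C S.b6 * (1 - C S.b1 * X) * (1 - C S.b4 * X) * (C t - C S.b6 * X)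

/-- `W - Δy V` as a polynomial. -/
noncomputable def minusPoly (S : System) (t : ℂ) : ℂ[X] :=
  (1 - C S.b2 * X) * (1 - C S.b3 * X) * (C (S.b6 * t) - X)

@[simp] theorem eval_plusPoly (x : ℂ) : (S.plusPoly t).eval x = S.spectralPlus t x := by
  simp [plusPoly, Params.spectralPlus]

@[simp] theorem eval_minusPoly (x : ℂ) : (S.minusPoly t).eval x = S.spectralMinus t x := by
  simp [minusPoly, Params.spectralMinus]

theorem natDegree_plusPoly_le : (S.plusPoly t).natDegree ≤ 3 := by
  unfold plusPoly; compute_degree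

theorem natDegree_minusPoly_le : (S.minusPoly t).natDegree ≤ 3 := by
  unfold minusPoly; compute_degree

theorem coeff_plusPoly : (S.plusPoly t).coeff 3 = -(S.b6 ^ 2 * S.b1 * S.b4) := by
  have e : S.plusPoly t = C (-(S.b6 ^ 2 * S.b1 * S.b4)) * X ^ 3 +
      C (S.b6 * (t * S.b1 * S.b4 + S.b6 * (S.b1 + S.b4))) * X ^ 2 +
      C (S.b6 * (-t * (S.b1 + S.b4) - S.b6)) * X + C (S.b6 * t) := by
    simp only [plusPoly, map_mul, map_add, map_sub, map_neg, map_pow]; ring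
  rw [e]; simp only [coeff_add, coeff_C_mul, coeff_X_pow, coeff_X, coeff_C]; norm_num

theorem coeff_minusPoly : (S.minusPoly t).coeff 3 = -(S.b2 * S.b3) := by
  have e : S.minusPoly t = C (-(S.b2 * S.b3)) * X ^ 3 +
      C (S.b6 * t * S.b2 * S.b3 + (S.b2 + S.b3)) * X ^ 2 +
      C (-(S.b6 * t) * (S.b2 + S.b3) - 1) * X + C (S.b6 * t) := by
    simp only [minusPoly, map_mul, map_add, map_sub, map_neg, map_one]; ring
  rw [e]; simp only [coeff_add, coeff_C_mul, coeff_X_pow, coeff_X, coeff_C]; norm_num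

theorem mul_right_cancel_of_isUnit_det {M N Y : Matrix (Fin 2) (Fin 2) ℂ} (hY : IsUnit Y.det)
    (h : M * Y = N * Y) : M = N := by
  rw [← Matrix.mul_nonsing_inv_cancel_right Y M hY, h, Matrix.mul_nonsing_inv_cancel_right Y N hY]

theorem isSpectral_unique (hO : S.IsOrthonormal t) (ha : S.a t S.n ≠ 0)
    {A B : Matrix (Fin 2) (Fin 2) ℂ[X]} (hA : S.IsSpectral t A) (hB : S.IsSpectral t B) :
    A = B := by
  ext1 i j
  refine eq_of_infinite_eval_eq _ _ ((infinite_isGeneric S t t).mono fun x hx => ?_)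
  have h := (hA x hx.1).symm.trans (hB x hx.1)
  exact congrFun (congrFun (mul_right_cancel_of_isUnit_det (isUnit_det_Y hO ha hx.1) h) i) j

/-- The spectral equation has a polynomial solution, so the matrix chosen by `spectralMatrix`
satisfies it; the other clauses describe the second column of that matrix. -/
theorem spectralMatrix_properties (ht : t ≠ 0) (hR : S.SupportRegular t) (hO : S.IsOrthonormal t)
    (ha : S.a t S.n ≠ 0) :
    S.IsSpectral t (S.spectralMatrix t) ∧ (S.spectralMatrix t 0 1).natDegree ≤ 2 ∧
    (S.spectralMatrix t 0 1).coeff 2 = S.a t S.n *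
      (S.b6 ^ 2 * S.b1 * S.b4 * S.q ^ S.n - S.q⁻¹ * (S.b2 * S.b3 * S.q⁻¹ ^ S.n)) ∧
    (S.spectralMatrix t 0 1).coeff 0 = 0 ∧ (S.spectralMatrix t 1 1).coeff 0 = S.b6 * t := by
  have hσ : ∀ y ∈ S.support t, (S.minusPoly t).eval y * S.weight t (S.q * y) =
      (S.plusPoly t).eval y * S.weight t y := fun y hy => by
    simpa using S.spectralMinus_mul_weight ht (weightDen_ne_zero_of_mem_support hR hy)
  obtain ⟨M, hM, hc⟩ := exists_transfer hO ha S.q_ne_zero (isRescaling_q ht) hσ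
  have hspec : S.IsSpectral t M := fun x hx => by
    simpa using hM x hx.1 hx.notMem_support hx.weight_ne_zero hx.mul_q.weight_ne_zero
      (by simpa using S.spectralMinus_mul_weight ht hx.2.2.1)
  have hMe : S.spectralMatrix t = M :=
    isSpectral_unique hO ha (Classical.epsilon_spec ⟨M, hspec⟩) hspec
  rw [hMe]
  have hl := leadingCoeff_p_ne_zero hO le_rfl
  have hp : (S.plusPoly t).coeff 0 = S.b6 * t := by
    simp [coeff_zero_eq_eval_zero, Params.spectralPlus]
  have hm : (S.minusPoly t).coeff 0 = S.b6 * t := by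
    simp [coeff_zero_eq_eval_zero, Params.spectralMinus]
  have htop : ∀ j, 2 ≤ j → _ := fun j hj => (hc 0 j).trans (congrArg (S.a t S.n * ·)
    (transfer_coeff_eq hO hO S.q_ne_zero (isRescaling_q ht)
      (natDegree_plusPoly_le.trans (by omega)) (natDegree_minusPoly_le.trans (by omega))))
  have hzero : ∀ i, (M i 1).coeff 0 = S.b6 * t * (S.a t S.n *
      (S.moment t (S.rowPoly t i * divX (S.rowPoly t 0)) -
      S.moment t (S.rowPoly t 0 * divX (S.rowPoly t i)) +
        S.rowConst t i * (S.rowPoly t 0).coeff 0)) := fun i => by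
    have h := transfer_coeff_zero ht hp hm hσ (S.rowPoly t i) (S.rowPoly t 0)
    rw [hc, zero_add, Function.iterate_one, h, mul_coeff_zero, hm]
    ring
  refine ⟨hspec, ?_, ?_, ?_, ?_⟩
  · rw [natDegree_le_iff_coeff_eq_zero]
    intro j hj
    rw [htop j hj.le, coeff_eq_zero_of_natDegree_lt (natDegree_plusPoly_le.trans_lt (by omega)),
      coeff_eq_zero_of_natDegree_lt (natDegree_minusPoly_le.trans_lt (by omega))]
    simp
  · rw [htop 2 le_rfl, coeff_plusPoly, coeff_minusPoly]
    field_simp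
    ring
  · rw [hzero]
    have : S.rowConst t 0 = 0 := rfl
    simp [this]
  · rw [hzero, (casoratian hO ha).2, mul_one]

/-- The determinant of the spectral matrix is `W² - Δy² V²`. -/
theorem det_spectralMatrix (ht : t ≠ 0) (hR : S.SupportRegular t) (hO : S.IsOrthonormal t)
    (ha : S.a t S.n ≠ 0) : (S.spectralMatrix t).det = S.plusPoly t * S.minusPoly t := by
  have hA := (spectralMatrix_properties ht hR hO ha).1
  refine eq_of_infinite_eval_eq _ _ ((infinite_isGeneric S t t).mono fun x hx => ?_)
  replace hx := hx.1
  have h := congrArg Matrix.det (hA x hx)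
  rw [Matrix.det_smul, Matrix.det_mul, Fintype.card_fin] at h
  have h1 := det_Y hO ha hx
  have h2 := det_Y hO ha hx.mul_q
  have h3 := S.spectralMinus_mul_weight ht hx.2.2.1
  have e : ((S.spectralMatrix t).map fun P => P.eval x).det = (S.spectralMatrix t).det.eval x :=
    ((evalRingHom x).map_det _).symm
  rw [e] at h
  have h4 := hx.weight_ne_zero
  have h5 := hx.mul_q.weight_ne_zero
  rw [Set.mem_ofPred_eq, eval_mul, eval_plusPoly, eval_minusPoly]
  generalize eval x (S.spectralMatrix t).det = d at *
  have h6 : (S.Y t x).det = 1 / (S.a t S.n * S.weight t x) := by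
    field_simp; linear_combination h1
  have h7 : (S.Y t (S.q * x)).det = 1 / (S.a t S.n * S.weight t (S.q * x)) := by
    field_simp; linear_combination h2
  rw [h6, h7] at h
  field_simp at h
  refine mul_right_cancel₀ h5 ?_
  linear_combination -h - S.spectralPlus t x * h3

/-! ### The zero `g` and the variable `f` -/

theorem b5_ne_zero : S.b5 ≠ 0 :=
  mul_ne_zero (pow_ne_zero _ S.q_ne_zero)
    (mul_ne_zero (mul_ne_zero S.b1_ne_zero S.b4_ne_zero) S.b6_ne_zero)

/-- The condition on `b₅` says that `τ` has exact degree two, so that `g(t)` exists. -/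
theorem coeff_two_spectralMatrix_ne_zero (ht : t ≠ 0) (hR : S.SupportRegular t)
    (hO : S.IsOrthonormal t) (ha : S.a t S.n ≠ 0) (hb5 : S.q * S.b5 ^ 2 ≠ 1) :
    (S.spectralMatrix t 0 1).coeff 2 ≠ 0 := by
  rw [(spectralMatrix_properties ht hR hO ha).2.2.1]
  refine mul_ne_zero ha fun h => hb5 ?_
  have hq := S.q_ne_zero
  have hp := S.prod_eq_one
  rw [inv_pow] at h
  field_simp at h
  rw [b5]
  linear_combination S.b1 * S.b4 * h + hp

/-- `g(t)` is a zero of the upper right entry of the spectral matrix. -/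
theorem eval_g_spectralMatrix (ht : t ≠ 0) (hR : S.SupportRegular t)
    (hO : S.IsOrthonormal t) (ha : S.a t S.n ≠ 0) (hb5 : S.q * S.b5 ^ 2 ≠ 1) :
    (S.spectralMatrix t 0 1).eval (S.g t) = 0 := by
  obtain ⟨-, -, -, h0, -⟩ := spectralMatrix_properties ht hR hO ha
  have h2 := coeff_two_spectralMatrix_ne_zero ht hR hO ha hb5
  have hk : ((S.q - 1) * S.a t S.n)⁻¹ ≠ 0 :=
    inv_ne_zero (mul_ne_zero (sub_ne_zero.2 S.q_ne_one) ha)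
  have hroot : ∃ z, (S.theta t).IsRoot z := by
    refine IsAlgClosed.exists_root _ fun hd => ?_
    have h1 : (S.theta t).coeff 1 = 0 :=
      coeff_eq_zero_of_degree_lt (by rw [hd]; exact_mod_cast Nat.zero_lt_one)
    rw [theta, coeff_C_mul, coeff_divX, coeff_neg] at h1
    exact mul_ne_zero hk (neg_ne_zero.2 h2) h1
  have hg : (S.theta t).IsRoot (S.g t) := Classical.epsilon_spec hroot
  rw [IsRoot, theta, eval_mul, eval_C, mul_eq_zero, or_iff_right hk] at hg
  have h := congrArg (eval (S.g t)) (divX_mul_X_add (-(S.spectralMatrix t 0 1)))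
  rw [eval_add, eval_mul, hg, coeff_neg, h0] at h
  simpa using h.symm

/-- The definition of `𝒵` and `z₊` unfolded: `b₅ t - 𝒵(t)` is `f` at the previous time. -/
theorem g_mul_sub_one (hg : S.g t ≠ 0) (hg1 : S.g t ≠ S.b6 * t) (hg2 : S.g t ≠ S.b6⁻¹ * t) :
    S.g t * (S.b5 * t - S.Z t) - 1 =
      -(t * (S.spectralMatrix t 0 0).eval (S.g t)) / ((S.g t - S.b6 * t) * (S.b6 * S.g t - t)) := by
  have h5 := S.b5_ne_zero
  have h6 := S.b6_ne_zero
  have hq := sub_ne_zero.2 S.q_ne_one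
  have h1 := sub_ne_zero.2 hg1
  have h2 : S.b6 * S.g t - t ≠ 0 := fun h => hg2 (by field_simp; linear_combination h)
  have hz : S.zPlus t = (S.spectralMatrix t 0 0).eval (S.g t) / (S.g t * -(S.b5 * S.b6)) := by
    have hk : -(S.b5 * S.b6) ≠ 0 := neg_ne_zero.2 (mul_ne_zero h5 h6)
    rw [zPlus, kappaPlus, nu, mu]
    field_simp
    ring
  rw [Z, hz]
  field_simp
  ring

/-! ### Compatibility of the spectral and the deformation equations -/

/-- On the support at time `t`, either both weights vanish or the shifted weight has no pole. -/
theorem weight_eq_zero_or_weightDen_ne_zero (ht : t ≠ 0) (hR : S.SupportRegular (S.q * t)) {y : ℂ}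
    (hy : y ∈ S.support t) :
    (S.weight t y = 0 ∧ S.weight (S.q * t) y = 0) ∨ S.weightDen (S.q * t) y ≠ 0 := by
  have hmem : ∀ i (s : ℕ), ∃ m : ℕ,
      S.terminal t i * S.q ^ (s + 1) = S.terminal (S.q * t) i * S.q ^ m := by
    intro i s
    fin_cases i
    · exact ⟨s + 1, by simp [Params.terminal]⟩
    · exact ⟨s + 1, by simp [Params.terminal]⟩
    · exact ⟨s, by simp [Params.terminal]; ring⟩
  obtain ⟨s, h⟩ := hy
  cases s with
  | zero =>
    simp only [pow_zero, mul_one] at h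
    rcases h with rfl | rfl <;>
      exact Or.inl ⟨S.weight_terminal ht _, S.weight_shift_terminal ht _⟩
  | succ s =>
    refine Or.inr (weightDen_ne_zero_of_mem_support hR ?_)
    rcases h with rfl | rfl
    · obtain ⟨m, hm⟩ := hmem S.lower s
      exact ⟨m, Or.inl hm⟩
    · obtain ⟨m, hm⟩ := hmem S.upper s
      exact ⟨m, Or.inr hm⟩

/-- The upper right entries of the two factorisations through `Y_n(q x; q t) Y_n(x; t)⁻¹` of the
compatibility relation. Orthogonality makes the deformation matrix constant, with value `u`, and the
mixed matrix linear, equal to `l₀ + l₁ x`, in that entry. -/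
theorem exists_compatibility (ht : t ≠ 0) (hR : S.SupportRegular t)
    (hR' : S.SupportRegular (S.q * t)) (hO : S.IsOrthonormal t) (hO' : S.IsOrthonormal (S.q * t))
    (ha : S.a t S.n ≠ 0) (ha' : S.a (S.q * t) S.n ≠ 0) :
    ∃ (β δ : ℂ[X]) (u l₀ l₁ : ℂ),
      (∀ x, β.eval (S.q * x) * (S.spectralMatrix t 0 1).eval x +
        u * (S.spectralMatrix t 1 1).eval x =
        S.b6 * S.q * ((S.b6 * t - x) * (t - S.b6 * x)) * (l₀ + l₁ * x)) ∧
      (∀ x, (S.spectralMatrix (S.q * t) 0 0).eval x * u +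
        (S.spectralMatrix (S.q * t) 0 1).eval x * δ.eval x =
        S.b6 * ((S.b6 * (S.q * t) - x) * (S.q * t - S.b6 * x)) * (l₀ + l₁ * x)) ∧
      (u = 0 → β ≠ 0) := by
  have ht' : S.q * t ≠ 0 := mul_ne_zero S.q_ne_zero ht
  have hA := (spectralMatrix_properties ht hR hO ha).1
  have hA' := (spectralMatrix_properties ht' hR' hO' ha').1
  have hI := isRescaling_shift (S := S) ht
  have hIq := isRescaling_shift_q (S := S) ht
  -- the deformation matrix `B`
  obtain ⟨B, hB, hBc⟩ := exists_transfer hO ha one_ne_zero hI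
    (σ₁ := C (S.b6 * (S.q * t)) - X) (σ₂ := C S.b6 * (C (S.q * t) - C S.b6 * X)) fun y hy => by
      rcases weight_eq_zero_or_weightDen_ne_zero ht hR' hy with ⟨h1, h2⟩ | h
      · simp [h1, h2]
      · simpa using S.shift_weight ht h
  -- the mixed matrix `N`
  obtain ⟨N, hN, hNc⟩ := exists_transfer hO ha S.q_ne_zero hIq
    (σ₁ := (1 - C S.b1 * X) * (1 - C S.b4 * X)) (σ₂ := (1 - C S.b2 * X) * (1 - C S.b3 * X))
    fun y hy => by
      simpa using S.shift_weight_q (weightDen_ne_zero_of_mem_support hR hy)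
  have hBd : (B 0 1).natDegree ≤ 0 := by
    have h1 : (C (S.b6 * (S.q * t)) - X).natDegree ≤ 1 := by compute_degree
    have h2 : (C S.b6 * (C (S.q * t) - C S.b6 * X)).natDegree ≤ 1 := by compute_degree
    rw [natDegree_le_iff_coeff_eq_zero]
    intro j hj
    rw [hBc, transfer_coeff_eq hO hO' one_ne_zero hI (h1.trans (by omega)) (h2.trans (by omega)),
      coeff_eq_zero_of_natDegree_lt (h1.trans_lt (by omega)),
      coeff_eq_zero_of_natDegree_lt (h2.trans_lt (by omega))]
    simp
  have hNd : (N 0 1).natDegree ≤ 1 := by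
    have h1 : ((1 - C S.b1 * X) * (1 - C S.b4 * X)).natDegree ≤ 2 := by compute_degree
    have h2 : ((1 - C S.b2 * X) * (1 - C S.b3 * X)).natDegree ≤ 2 := by compute_degree
    rw [natDegree_le_iff_coeff_eq_zero]
    intro j hj
    rw [hNc, transfer_coeff_eq hO hO' S.q_ne_zero hIq (h1.trans (by omega)) (h2.trans (by omega)),
      coeff_eq_zero_of_natDegree_lt (h1.trans_lt (by omega)),
      coeff_eq_zero_of_natDegree_lt (h2.trans_lt (by omega))]
    simp
  obtain ⟨u, hu⟩ := natDegree_eq_zero.1 (Nat.le_zero.1 hBd)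
  obtain ⟨l₁, l₀, hl⟩ := exists_eq_X_add_C_of_natDegree_le_one hNd
  have hB' : ∀ x, S.IsGeneric t x → S.IsGeneric (S.q * t) x →
      (S.b6 * (S.q * t) - x) • S.Y (S.q * t) x = B.map (fun P => P.eval x) * S.Y t x :=
    fun x hx hx' => by
      simpa using hB x hx.1 hx.notMem_support hx.weight_ne_zero (by simpa using hx'.weight_ne_zero)
        (by simpa using S.shift_weight ht hx'.2.2.1)
  have hN' : ∀ x, S.IsGeneric t x → S.IsGeneric (S.q * t) x →
      ((1 - S.b1 * x) * (1 - S.b4 * x)) • S.Y (S.q * t) (S.q * x) =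
        N.map (fun P => P.eval x) * S.Y t x := fun x hx hx' => by
      simpa using hN x hx.1 hx.notMem_support hx.weight_ne_zero hx'.mul_q.weight_ne_zero
        (by simpa using S.shift_weight_q hx.2.2.1)
  refine ⟨B 0 0, B 1 1, u, l₀, l₁, fun x => ?_, fun x => ?_, fun hu0 hβ => ?_⟩
  · have key : (B 0 0).comp (C S.q * X) * S.spectralMatrix t 0 1 + C u * S.spectralMatrix t 1 1 =
        C (S.b6 * S.q) * ((C (S.b6 * t) - X) * (C t - C S.b6 * X)) * N 0 1 := by
      refine eq_of_infinite_eval_eq _ _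
        ((infinite_isGeneric S t (S.q * t)).mono fun x hxx => ?_)
      obtain ⟨hx, hx'⟩ := hxx
      have e : B.map (fun P => P.eval (S.q * x)) *
          (S.spectralMatrix t).map (fun P => P.eval x) =
          (S.b6 * S.q * ((S.b6 * t - x) * (t - S.b6 * x))) • N.map (fun P => P.eval x) := by
        refine mul_right_cancel_of_isUnit_det (isUnit_det_Y hO ha hx) ?_
        rw [Matrix.mul_assoc, ← hA x hx, Matrix.mul_smul, ← hB' _ hx.mul_q hx'.mul_q,
          Matrix.smul_mul, ← hN' x hx hx', smul_smul, smul_smul, Params.spectralPlus]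
        congr 1; ring
      have e01 := congrFun (congrFun e 0) 1
      simp only [Matrix.mul_apply, Fin.sum_univ_two, Matrix.map_apply, Matrix.smul_apply,
        smul_eq_mul, ← hu, eval_C] at e01
      simpa using e01
    have h := congrArg (eval x) key
    simp only [hl, eval_add, eval_mul, eval_comp, eval_C, eval_X, eval_sub] at h
    linear_combination h
  · have key : S.spectralMatrix (S.q * t) 0 0 * C u + S.spectralMatrix (S.q * t) 0 1 * B 1 1 =
        C S.b6 * ((C (S.b6 * (S.q * t)) - X) * (C (S.q * t) - C S.b6 * X)) * N 0 1 := by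
      refine eq_of_infinite_eval_eq _ _
        ((infinite_isGeneric S t (S.q * t)).mono fun x hxx => ?_)
      obtain ⟨hx, hx'⟩ := hxx
      have e : (S.spectralMatrix (S.q * t)).map (fun P => P.eval x) *
          B.map (fun P => P.eval x) =
          (S.b6 * ((S.b6 * (S.q * t) - x) * (S.q * t - S.b6 * x))) •
            N.map (fun P => P.eval x) := by
        refine mul_right_cancel_of_isUnit_det (isUnit_det_Y hO ha hx) ?_
        rw [Matrix.mul_assoc, ← hB' x hx hx', Matrix.mul_smul, ← hA' x hx',
          Matrix.smul_mul, ← hN' x hx hx', smul_smul, smul_smul, Params.spectralPlus]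
        congr 1; ring
      have e01 := congrFun (congrFun e 0) 1
      simp only [Matrix.mul_apply, Fin.sum_univ_two, Matrix.map_apply, Matrix.smul_apply,
        smul_eq_mul, ← hu, eval_C] at e01
      simpa using e01
    have h := congrArg (eval x) key
    simp only [hl, eval_add, eval_mul, eval_C, eval_X, eval_sub] at h
    linear_combination h
  · have key : (C (S.b6 * (S.q * t)) - X) * S.p (S.q * t) S.n = 0 := by
      refine eq_of_infinite_eval_eq _ _
        ((infinite_isGeneric S t (S.q * t)).mono fun x hxx => ?_)
      obtain ⟨hx, hx'⟩ := hxx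
      have e := congrFun (congrFun (hB' x hx hx') 0) 0
      simp only [Matrix.mul_apply, Fin.sum_univ_two, Matrix.map_apply, Matrix.smul_apply,
        smul_eq_mul, ← hu, hu0, hβ, Y_zero, eval_C, eval_zero, zero_mul, add_zero] at e
      simpa [rowPoly] using e
    rcases mul_eq_zero.1 key with h | h
    · have := congrArg (fun P => P.coeff 1) h
      simp at this
    · exact leadingCoeff_p_ne_zero hO' le_rfl (by rw [h, leadingCoeff_zero])

end System
end DeformedBigQJacobi

open DeformedBigQJacobi DeformedBigQJacobi.System Polynomial in
theorem mainTheorem2 (S : DeformedBigQJacobi.System) (t : ℂ) (ht : t ≠ 0)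
    (hb5 : S.q * S.b5 ^ 2 ≠ 1)
    (hS : ∀ s ∈ ({t, S.q * t} : Set ℂ),
      S.SupportRegular s ∧ S.IsOrthonormal s ∧ S.a s S.n ≠ 0 ∧
      S.g s ≠ 0 ∧ S.g s ≠ S.b6 * s ∧ S.g s ≠ S.b6⁻¹ * s) :
    (S.g t * S.f (S.q⁻¹ * t) - 1) * (S.g t * S.f t - 1) =
      t ^ 2 * ((S.g t - S.b1⁻¹) * (S.g t - S.b2⁻¹) * (S.g t - S.b3⁻¹) * (S.g t - S.b4⁻¹)) /
        ((S.g t - S.b6 * t) * (S.g t - S.b6⁻¹ * t)) := by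
  obtain ⟨hR, hO, ha, hg, hg1, hg2⟩ := hS t (by simp)
  obtain ⟨hR', hO', ha', hg', hg1', hg2'⟩ := hS (S.q * t) (by simp)
  have hq := S.q_ne_zero
  have h6 := S.b6_ne_zero
  have ht' : S.q * t ≠ 0 := mul_ne_zero hq ht
  obtain ⟨β, δ, u, l₀, l₁, hI, hII, hu⟩ := exists_compatibility ht hR hR' hO hO' ha ha'
  obtain ⟨-, -, -, hτ0, hW0⟩ := spectralMatrix_properties ht hR hO ha
  rw [coeff_zero_eq_eval_zero] at hτ0 hW0
  have hτg := eval_g_spectralMatrix ht hR hO ha hb5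
  have hτg' := eval_g_spectralMatrix ht' hR' hO' ha' hb5
  have hdet := congrArg (eval (S.g t)) (det_spectralMatrix ht hR hO ha)
  rw [Matrix.det_fin_two, eval_sub, eval_mul, eval_mul, hτg, zero_mul, sub_zero, eval_mul,
    eval_plusPoly, eval_minusPoly, Params.spectralPlus, Params.spectralMinus] at hdet
  have d1 : S.g t - S.b6 * t ≠ 0 := sub_ne_zero.2 hg1
  have d2 : S.b6 * S.g t - t ≠ 0 := fun h => hg2 (by field_simp; linear_combination h)
  have d1' : S.g (S.q * t) - S.b6 * (S.q * t) ≠ 0 := sub_ne_zero.2 hg1'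
  have d2' : S.b6 * S.g (S.q * t) - S.q * t ≠ 0 := fun h =>
    hg2' (by field_simp; linear_combination h)
  -- the compatibility relations at `0`, `g(t)` and `g(q t)`, where the spectral matrix is
  -- triangular
  have e0 : u = S.b6 * S.q * t * l₀ := by
    have h := hI 0
    rw [hτ0, hW0] at h
    refine mul_left_cancel₀ (mul_ne_zero h6 ht) ?_
    linear_combination h
  have e1 := hI (S.g t)
  rw [hτg, mul_zero, zero_add] at e1
  have e2 := hII (S.g (S.q * t))
  rw [hτg', zero_mul, add_zero] at e2
  -- otherwise the mixed matrix would vanish in its upper right entry at `0` and at `g(t)`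
  have hu0 : u ≠ 0 := by
    intro h0
    have hl0 : l₀ = 0 := by
      rw [h0] at e0
      simpa [h6, hq, ht] using e0.symm
    have hl1 : l₁ = 0 := by
      rw [h0, hl0, zero_mul, zero_add] at e1
      have h3 : S.b6 * S.q * ((S.g t - S.b6 * t) * (S.b6 * S.g t - t)) * (l₁ * S.g t) = 0 := by
        linear_combination -e1
      simpa [h6, hq, d1, d2, hg] using h3
    have hprod : β.comp (C S.q * X) * S.spectralMatrix t 0 1 = 0 := Polynomial.funext fun x => by
      simpa [h0, hl0, hl1] using hI x
    rcases mul_eq_zero.1 hprod with h | h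
    · refine hu h0 (Polynomial.ext fun j => ?_)
      have := congrArg (fun P => P.coeff j) h
      simpa [comp_C_mul_X_coeff, hq] using this
    · exact coeff_two_spectralMatrix_ne_zero ht hR hO ha hb5 (by rw [h, coeff_zero])
  have f1 := g_mul_sub_one hg hg1 hg2
  have f2 := g_mul_sub_one hg' hg1' hg2'
  have hf1 : S.f (S.q⁻¹ * t) = S.b5 * t - S.Z t := by rw [f, mul_inv_cancel_left₀ hq]
  have hf2 : S.f t = S.b5 * (S.q * t) - S.Z (S.q * t) := rfl
  rw [← hf1] at f1
  rw [← hf2] at f2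
  -- the value of `ℓ` at `g(q t)` cancels, so that `f` depends only on the coefficients of `ℓ`
  have hf : S.f t = -(S.q * t * S.b6 * l₁) / u := by
    rw [eq_div_iff hu0]
    refine mul_left_cancel₀ hg' ?_
    rw [eq_div_iff (mul_ne_zero d1' d2')] at f2
    refine mul_right_cancel₀ (mul_ne_zero d1' d2') ?_
    linear_combination u * f2 - S.q * t * e2 +
      (S.g (S.q * t) - S.b6 * (S.q * t)) * (S.b6 * S.g (S.q * t) - S.q * t) * e0
  have f3 : S.g t * S.f t - 1 = -(t * (S.spectralMatrix t 1 1).eval (S.g t)) /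
      ((S.g t - S.b6 * t) * (S.b6 * S.g t - t)) := by
    rw [eq_div_iff (mul_ne_zero d1 d2)]
    refine mul_left_cancel₀ hu0 ?_
    have hf' : S.f t * u = -(S.q * t * S.b6 * l₁) := by rw [hf, div_mul_cancel₀ _ hu0]
    linear_combination (S.g t - S.b6 * t) * (S.b6 * S.g t - t) * (S.g t * hf' - e0) + t * e1
  have hb : (S.g t - S.b1⁻¹) * (S.g t - S.b2⁻¹) * (S.g t - S.b3⁻¹) * (S.g t - S.b4⁻¹) =
      (1 - S.b1 * S.g t) * (1 - S.b2 * S.g t) * (1 - S.b3 * S.g t) * (1 - S.b4 * S.g t) := by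
    have r : ∀ b : ℂ, b ≠ 0 → 1 - b * S.g t = -b * (S.g t - b⁻¹) := fun b hb => by
      field_simp; ring
    rw [r _ S.b1_ne_zero, r _ S.b2_ne_zero, r _ S.b3_ne_zero, r _ S.b4_ne_zero]
    linear_combination -((S.g t - S.b1⁻¹) * (S.g t - S.b2⁻¹) * (S.g t - S.b3⁻¹) *
      (S.g t - S.b4⁻¹)) * S.prod_eq_one
  have hden' : S.g t - S.b6⁻¹ * t = (S.b6 * S.g t - t) / S.b6 := by field_simp
  have hdet' : (S.spectralMatrix t 0 0).eval (S.g t) * (S.spectralMatrix t 1 1).eval (S.g t) =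
      S.b6 * ((1 - S.b1 * S.g t) * (1 - S.b2 * S.g t) * (1 - S.b3 * S.g t) * (1 - S.b4 * S.g t)) *
        ((S.g t - S.b6 * t) * (S.b6 * S.g t - t)) := by
    rw [hdet]; ring
  have hdenom : (S.g t - S.b6 * t) * (S.g t - S.b6⁻¹ * t) =
      (S.g t - S.b6 * t) * (S.b6 * S.g t - t) / S.b6 := by field_simp
  have d := mul_ne_zero d1 d2
  rw [f1, f3, hb, hdenom, div_mul_div_comm, neg_mul_neg, mul_mul_mul_comm, hdet',
    div_div_eq_mul_div, div_eq_div_iff (mul_ne_zero d d) d]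
  ring
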